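/- Let $q$ be an odd prime power with $q\equiv 7 \pmod{10}$, and put $n=\frac{q^2+1}{10}$, $r=q+1$, $s=\frac{q^2+1}{2}$. Let $\alpha\in\mathbb F_{q^2}^*$ be a primitive $r$-th root of unity and let $\delta$, in an extension field of $\mathbb F_{q^2}$, be a primitive $rn$-th root of unity with $\delta^n=\alpha$. For an integer $i$ let $C_i=\{iq^{2j} \bmod rn : j\ge 0\}$ be its $q^2$-cyclotomic coset modulo $rn$. Let $1\le\lambda\le\frac{q-7}{10}$ be an integer and let $\mathcal C=\langle g(x)\rangle\subseteq\mathbb F_{q^2}[x]/\langle x^n-\alpha\rangle$, with $g$ monic and $g\mid x^n-\alpha$, be the $\alpha$-constacyclic code of length $n$ whose defining set $\{i\in\{1+rj : 0\le j\le n-1\} : g(\delta^i)=0\}$ (modulo $rn$) is $$T=\bigcup_{j=0}^{\frac{2q+1}{5}+\lambda} C_{s-rj}.$$ Put $k=n-\frac45(2q+1)-4\lambda+7$ and $d=\frac25(2q+1)+2\lambda+2$. Then $\mathcal C$ has minimum distance $d$; every parity check matrix $H$ of $\mathcal C$ satisfies $\operatorname{rank}(HH^*)=9$, where $H^*$ is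 the conjugate transpose of $H$ with respect to $x\mapsto x^q$; $k=2\dim\mathcal C-n+9$; and there exists an entanglement-assisted quantum code with parameters $$[[\,n,\ n-\tfrac45(2q+1)-4\lambda+7,\ \tfrac25(2q+1)+2\lambda+2;\ 9\,]]_q,$$ that is, a code which encodes $k$ qudits of dimension $q$ into $n$ qudits, uses $9$ maximally entangled pairs of qudits shared by sender and receiver (the receiver's halves being free of errors), and has minimum distance exactly $d$. It attains equality $n+9-k=2(d-1)$ in the entanglement-assisted Singleton bound, and if $q\neq 17$ then also $d\le\frac{n+2}{2}$, so that it is an entanglement-assisted quantum MDS (EAQMDS) code. -/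

import Mathlib

/-! ### Constacyclic codes over a field with `q ^ 2` elements -/

/-- The constacyclic shift `(c₀, …, cₙ₋₁) ↦ (α cₙ₋₁, c₀, …, cₙ₋₂)`. -/
def constaShift {F : Type*} [Field F] {n : ℕ} (α : F) (c : Fin n → F) : Fin n → F :=
  fun i => if i.val = 0 then α * c ⟨n - 1, by have := i.isLt; omega⟩
    else c ⟨i.val - 1, by have := i.isLt; omega⟩

/-- A linear code is `α`-constacyclic if it is closed under the constacyclic shift. -/
def IsConstacyclic {F : Type*} [Field F] {n : ℕ} (α : F) (C : Submodule F (Fin n → F)) : Prop :=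
  ∀ c ∈ C, constaShift α c ∈ C

/-- The polynomial `c₀ + c₁ X + ⋯ + cₙ₋₁ Xⁿ⁻¹` of a word. -/
noncomputable def wordPoly {F : Type*} [Field F] {n : ℕ} (c : Fin n → F) : Polynomial F :=
  ∑ i : Fin n, Polynomial.C (c i) * Polynomial.X ^ i.val

/-- `C = ⟨g⟩` in `F[X] / (Xⁿ - α)`, with `g` monic and `g ∣ Xⁿ - α`. -/
structure IsGeneratorPoly {F : Type*} [Field F] {n : ℕ} (α : F) (C : Submodule F (Fin n → F))
    (g : Polynomial F) : Prop where
  monic : g.Monic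
  dvd : g ∣ Polynomial.X ^ n - Polynomial.C α
  mem_iff : ∀ c : Fin n → F, c ∈ C ↔ g ∣ wordPoly c

/-- The exponents `i ∈ {1 + r j | 0 ≤ j ≤ n - 1}` modulo `r n` for which `δ ^ i` is a root of the
generator polynomial `g`; here `δ` is a primitive `r n`-th root of unity in an extension field. -/
def definingSet {F K : Type*} [Field F] [Field K] [Algebra F K] (r n : ℕ) (δ : K)
    (g : Polynomial F) : Set (ZMod (r * n)) :=
  {i | (∃ j : ℕ, j < n ∧ i = 1 + (r : ZMod (r * n)) * (j : ZMod (r * n))) ∧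
    Polynomial.aeval (δ ^ i.val) g = 0}

/-- The `q ^ 2`-cyclotomic coset of `i` modulo `N`. -/
def cyclotomicCoset (q N : ℕ) (i : ZMod N) : Set (ZMod N) :=
  {x | ∃ j : ℕ, x = i * (q : ZMod N) ^ (2 * j)}

/-- `d` is the minimum weight of the nonzero words of the linear code `C`. -/
def HasMinWeight {F : Type*} [Field F] [DecidableEq F] {n : ℕ} (C : Submodule F (Fin n → F))
    (d : ℕ) : Prop :=
  IsLeast {w | ∃ c ∈ C, c ≠ 0 ∧ hammingNorm c = w} d

/-- `H` is a parity check matrix of `C`, with linearly independent rows. -/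
def IsParityCheck {F : Type*} [Field F] {m n : ℕ} (C : Submodule F (Fin n → F))
    (H : Matrix (Fin m) (Fin n) F) : Prop :=
  LinearIndependent F H.row ∧ ∀ x : Fin n → F, x ∈ C ↔ H.mulVec x = 0

/-- The conjugate transpose of a matrix over a field with `q ^ 2` elements, for the conjugation
`x ↦ x ^ q`. -/
def hermTranspose {F : Type*} [Field F] {m n : ℕ} (q : ℕ) (H : Matrix (Fin m) (Fin n) F) :
    Matrix (Fin n) (Fin m) F :=
  fun j i => H i j ^ q

/-! ### Entanglement-assisted quantum codes -/

/-- An entanglement-assisted quantum code that encodes `k` qudits of dimension `q` into `n` qudits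
with the help of `c` maximally entangled pairs of qudits shared by sender and receiver.

The registers of `m` qudits have the Hilbert space with orthonormal basis `Fin m → Fin q`. The
encoder is an isometry which the sender applies to the `k` message qudits together with her halves
of the `c` pairs (a unitary operation on these and on `n - k - c` ancillas in a fixed state). -/
structure EACode (q n k c : ℕ) where
  encoder : Matrix (Fin n → Fin q) ((Fin k → Fin q) × (Fin c → Fin q)) ℂ
  isometry : encoder.conjTranspose * encoder = 1

/-- The map that takes a message `ψ` to the joint state of the `n` transmitted qudits and the `c`
qudits kept by the receiver: the encoder applied to `ψ ⊗ Φ`, for the maximally entangled state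
`Φ = q ^ (- c / 2) ∑_b |b⟩ ⊗ |b⟩`. Its range is the code, a subspace of dimension `q ^ k`. -/
noncomputable def EACode.encode {q n k c : ℕ} (Q : EACode q n k c) :
    Matrix ((Fin n → Fin q) × (Fin c → Fin q)) (Fin k → Fin q) ℂ :=
  fun ab x => (((Real.sqrt ((q : ℝ) ^ c))⁻¹ : ℝ) : ℂ) * Q.encoder ab.1 (x, ab.2)

/-- The operator `E` on `n` qudits acts only on the qudits in `S`, i.e. `E = e ⊗ 1` for an operator
`e` on the qudits in `S`. -/
def ActsOn {q n : ℕ} (S : Finset (Fin n))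
    (E : Matrix (Fin n → Fin q) (Fin n → Fin q) ℂ) : Prop :=
  ∃ e : Matrix (S → Fin q) (S → Fin q) ℂ, ∀ x y : Fin n → Fin q,
    ((∀ i, i ∉ S → x i = y i) → E x y = e (fun i => x i) (fun i => y i)) ∧
    ((¬ ∀ i, i ∉ S → x i = y i) → E x y = 0)

/-- The Knill-Laflamme condition for detecting the error `E` on the transmitted qudits, where the
receiver's halves of the entangled pairs are free of errors: `E ⊗ 1`, compressed to the code, is a
scalar. -/
def EACode.Detects {q n k c : ℕ} (Q : EACode q n k c)
    (E : Matrix (Fin n → Fin q) (Fin n → Fin q) ℂ) : Prop :=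
  ∃ z : ℂ, Q.encode.conjTranspose *
    Matrix.kronecker E (1 : Matrix (Fin c → Fin q) (Fin c → Fin q) ℂ) * Q.encode =
      z • (1 : Matrix (Fin k → Fin q) (Fin k → Fin q) ℂ)

/-- The minimum distance is `d`, i.e. the code has parameters `[[n, k, d; c]]_q`: all errors on
fewer than `d` qudits are detected, but some error on `d` qudits is not. -/
def EACode.HasMinDist {q n k c : ℕ} (Q : EACode q n k c) (d : ℕ) : Prop :=
  (∀ S : Finset (Fin n), S.card < d → ∀ E, ActsOn S E → Q.Detects E) ∧
  ∃ S : Finset (Fin n), S.card = d ∧ ∃ E, ActsOn S E ∧ ¬ Q.Detects E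

/-- Equality `n + c - k = 2 (d - 1)` in the entanglement-assisted Singleton bound. -/
def MeetsEASingleton (n k d c : ℕ) : Prop :=
  (n : ℤ) + c - k = 2 * ((d : ℤ) - 1)

/-- An entanglement-assisted quantum MDS code: a code with parameters `[[n, k, d; c]]_q`, where
`d ≤ (n + 2) / 2`, that meets the entanglement-assisted Singleton bound. -/
def EACode.IsEAQMDS {q n k c : ℕ} (Q : EACode q n k c) (d : ℕ) : Prop :=
  Q.HasMinDist d ∧ MeetsEASingleton n k d c ∧ (d : ℚ) ≤ ((n : ℚ) + 2) / 2

/-! Write q = 10t+7, so that n = 10t²+14t+5 and 10n = q²+1, and put m = 4t+3+λ, β = δ^s, ζ = δ^r.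
Modulo rn, multiplication by q² fixes s and negates r. Hence the coset of s - rj is {s - rj, s +
rj}, and the zeros of g are the 2m+1 consecutive values βζ^j with |j| ≤ m
(`isRootInterval_of_definingSet`). The BCH bound gives weight at least 2m+2 = d, and g, having at
most 2m+2 coefficients, attains it.

The rank of HH* equals that of the Gram matrix `zeroGram` of the evaluation vectors at the zeros
(`IsRootInterval.rank_hermitian`). Since β^(q+1) = 1, its entry (i, j) is n if n divides i + qj and
0 otherwise. A nonzero entry is thus a point (j, -i) of the lattice y ≡ qx mod n in the box of
radius m. This is a square lattice with orthogonal basis (t+1, 3t+2), (-(3t+2), t+1), both of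
squared length n. As 4t+3 ≤ m ≤ 5t+3, the box holds exactly the nine combinations with coefficients
in {-1, 0, 1} (`lattice_short_vector`), and these form a partial permutation matrix
(`rank_zeroGram`).

For the quantum code let D be the Hermitian dual of C. Then dim D - dim (C ∩ D) = rank HH* = 9 and
dim C - dim (C ∩ D) = k. The form Tr(γ u v^q) with γ^q = -γ turns Hermitian duality into symplectic
duality over the prime field (`exists_eaCode_of_hermitian`). Modulo C ∩ D, both C and D split into
hyperbolic pairs (x, z). The x's of C shift the message, the x's of D shift the sender's halves of
the entangled pairs, and C ∩ D together with all z's stabilizes the initial state. A Weyl error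
outside C is detected; one in C but not in D is not (`exists_eaCode_of_symplectic`). Errors on fewer
than d qudits expand in Weyl operators of weight below d, so they are detected. The shifts of g all
have weight d and span C, which is not contained in D because k > 0; hence some error of weight d is
undetected. -/

/-! ### Hyperbolic families in spaces with an alternating form -/

/-- Families `x`, `z` with `ω (x i) (z j) = δ i j` and all other products zero. -/
structure IsHyperbolic {k V ι : Type*} [Field k] [AddCommGroup V] [Module k V] [DecidableEq ι]
    (ω : V →ₗ[k] V →ₗ[k] k) (x z : ι → V) : Prop where
  xx : ∀ i j, ω (x i) (x j) = 0
  zz : ∀ i j, ω (z i) (z j) = 0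
  xz : ∀ i j, ω (x i) (z j) = if i = j then 1 else 0

section Hyperbolic

variable {k V : Type*} [Field k] [AddCommGroup V] [Module k V] {ω : V →ₗ[k] V →ₗ[k] k}

/-- The products of a vector with the members of two families. -/
def pairingCoords {ι : Type*} (ω : V →ₗ[k] V →ₗ[k] k) (x z : ι → V) :
    V →ₗ[k] (ι → k) × (ι → k) :=
  (LinearMap.pi fun i => ω.flip (z i)).prod (LinearMap.pi fun i => ω.flip (x i))

theorem pairingCoords_apply {ι : Type*} (x z : ι → V) (v : V) :
    pairingCoords ω x z v = (fun i => ω v (z i), fun i => ω v (x i)) := rfl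

theorem IsHyperbolic.zx {ι : Type*} [DecidableEq ι] {x z : ι → V} (h : IsHyperbolic ω x z)
    (hω : ω.IsAlt) (i j : ι) : ω (z i) (x j) = if i = j then -1 else 0 := by
  rw [← hω.neg, h.xz]
  by_cases hij : i = j
  · simp [hij]
  · simp [hij, Ne.symm hij]

/-- The combination of a hyperbolic family with prescribed coordinates. -/
def hyperbolicSum {ι : Type*} [Fintype ι] (x z : ι → V) (a b : ι → k) : V :=
  ∑ i, (a i • x i - b i • z i)

/-- The minus sign in `hyperbolicSum` compensates ω (z i) (x i) = -1, which makes it a right inverse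
of `pairingCoords`. -/
theorem IsHyperbolic.pairing_left {ι : Type*} [Fintype ι] [DecidableEq ι] {x z : ι → V}
    (h : IsHyperbolic ω x z) (hω : ω.IsAlt) (a b : ι → k) :
    pairingCoords ω x z (hyperbolicSum x z a b) = (a, b) := by
  rw [pairingCoords_apply]
  ext j <;> simp [hyperbolicSum, h.xx, h.zz, h.xz, h.zx hω]

theorem IsHyperbolic.surjective {ι : Type*} [Fintype ι] [DecidableEq ι] {x z : ι → V}
    (h : IsHyperbolic ω x z) (hω : ω.IsAlt) : Function.Surjective (pairingCoords ω x z) :=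
  fun ab => ⟨hyperbolicSum x z ab.1 ab.2, h.pairing_left hω ab.1 ab.2⟩

theorem IsHyperbolic.snoc {m : ℕ} {x z : Fin m → V} (h : IsHyperbolic ω x z) (hω : ω.IsAlt)
    {u v : V} (hux : ∀ i, ω u (x i) = 0) (huz : ∀ i, ω u (z i) = 0)
    (hvx : ∀ i, ω v (x i) = 0) (hvz : ∀ i, ω v (z i) = 0) (huv : ω u v = 1) :
    IsHyperbolic ω (Fin.snoc x u : Fin (m + 1) → V) (Fin.snoc z v : Fin (m + 1) → V) := by
  have hxu : ∀ i, ω (x i) u = 0 := fun i => by rw [← hω.neg, hux, neg_zero]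
  have hzv : ∀ i, ω (z i) v = 0 := fun i => by rw [← hω.neg, hvz, neg_zero]
  have hxv : ∀ i, ω (x i) v = 0 := fun i => by rw [← hω.neg, hvx, neg_zero]
  constructor
  · intro i j
    refine Fin.lastCases ?_ (fun i => ?_) i <;> refine Fin.lastCases ?_ (fun j => ?_) j <;>
      simp [hux, hxu, h.xx, hω u]
  · intro i j
    refine Fin.lastCases ?_ (fun i => ?_) i <;> refine Fin.lastCases ?_ (fun j => ?_) j <;>
      simp [hvz, hzv, h.zz, hω v]
  · intro i j
    refine Fin.lastCases ?_ (fun i => ?_) i <;> refine Fin.lastCases ?_ (fun j => ?_) j <;>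
      simp [huz, hxv, h.xz, huv, Fin.castSucc_ne_last, (Fin.castSucc_ne_last _).symm]

/-- An alternating form has a hyperbolic family which spans the space modulo the radical. -/
theorem exists_isHyperbolic [FiniteDimensional k V] (hω : ω.IsAlt) :
    ∃ (m : ℕ) (x z : Fin m → V), IsHyperbolic ω x z ∧
      (∀ v, pairingCoords ω x z v = 0 → ∀ u, ω v u = 0) ∧
      Module.finrank k V = Module.finrank k (LinearMap.ker ω) + 2 * m := by
  classical
  let P : ℕ → Prop := fun m => ∃ x z : Fin m → V, IsHyperbolic ω x z
  have hP0 : P 0 := ⟨Fin.elim0, Fin.elim0, ⟨fun i => i.elim0, fun i => i.elim0, fun i => i.elim0⟩⟩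
  have hbound : ∀ m, P m → m ≤ Module.finrank k V := by
    rintro m ⟨x, z, h⟩
    have := LinearMap.finrank_le_finrank_of_surjective (h.surjective hω)
    simp at this
    omega
  obtain ⟨m, hm, x, z, h⟩ : ∃ m, m = Nat.findGreatest P (Module.finrank k V) ∧ P m :=
    ⟨_, rfl, Nat.findGreatest_spec (P := P) (Nat.zero_le (Module.finrank k V)) hP0⟩
  -- A vector v orthogonal to a maximal family lies in the radical: if ω v u ≠ 0, removing from u
  -- its hyperbolic part and rescaling gives a partner for v, and the family would grow.
  have hrad : ∀ v, pairingCoords ω x z v = 0 → ∀ u, ω v u = 0 := by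
    intro v hv u
    by_contra hne
    rw [pairingCoords_apply, Prod.mk_eq_zero] at hv
    have hvz : ∀ i, ω v (z i) = 0 := fun i => congrFun hv.1 i
    have hvx : ∀ i, ω v (x i) = 0 := fun i => congrFun hv.2 i
    let y := u - hyperbolicSum x z (fun i => ω u (z i)) (fun i => ω u (x i))
    have hy : pairingCoords ω x z y = 0 := by
      rw [map_sub, h.pairing_left hω, pairingCoords_apply, sub_self]
    rw [pairingCoords_apply, Prod.mk_eq_zero] at hy
    have hvy : ω v y = ω v u := by
      simp [y, hyperbolicSum, hvz, hvx]
    have hsn : P (m + 1) := ⟨_, _, h.snoc hω (u := v) (v := (ω v u)⁻¹ • y) hvx hvz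
      (fun i => by simpa using Or.inr (congrFun hy.2 i))
      (fun i => by simpa using Or.inr (congrFun hy.1 i))
      (by rw [map_smul, hvy, smul_eq_mul, inv_mul_cancel₀ hne])⟩
    have := Nat.le_findGreatest (hbound _ hsn) hsn
    omega
  refine ⟨m, x, z, h, hrad, ?_⟩
  have hker : LinearMap.ker (pairingCoords ω x z) = LinearMap.ker ω := by
    ext v
    rw [LinearMap.mem_ker, LinearMap.mem_ker]
    refine ⟨fun hv => LinearMap.ext (hrad v hv), fun hv => ?_⟩
    rw [pairingCoords_apply, hv]
    rfl
  have hrn := (pairingCoords ω x z).finrank_range_add_finrank_ker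
  rw [hker, LinearMap.range_eq_top.2 (h.surjective hω), finrank_top] at hrn
  simp at hrn
  omega

end Hyperbolic

/-! ### Weyl operators -/

/-- A projective representation of `G` by Weyl operators with commutation form `ω`. -/
structure WeylSystem (p : ℕ) [Fact p.Prime] {G : Type*} [AddCommGroup G] [Module (ZMod p) G]
    (ω : G →ₗ[ZMod p] G →ₗ[ZMod p] ZMod p) (I : Type*) [Fintype I] [DecidableEq I] where
  op : G → Matrix I I ℂ
  op_zero : op 0 = 1
  op_mul : ∀ u v, op u * op v = ZMod.stdAddChar (2⁻¹ * ω u v) • op (u + v)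
  op_adj : ∀ u, (op u).conjTranspose = op (-u)
  op_trace : ∀ u, u ≠ 0 → (op u).trace = 0

theorem AddChar.sum_comp_linearMap_eq_zero {p : ℕ} [Fact p.Prime] {Y : Type*} [AddCommGroup Y]
    [Module (ZMod p) Y] [Fintype Y] (f : Y →ₗ[ZMod p] ZMod p) {y : Y} (hy : f y ≠ 0) :
    ∑ y, ZMod.stdAddChar (N := p) (f y) = 0 := by
  set χ : AddChar Y ℂ := (ZMod.stdAddChar (N := p)).compAddMonoidHom f.toAddMonoidHom with hχ
  have hne : χ ≠ 0 := by
    intro h0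
    have h1 := DFunLike.congr_fun h0 y
    have h2 : ZMod.stdAddChar (N := p) (f y) = ZMod.stdAddChar (N := p) 0 := by
      rw [AddChar.map_zero_eq_one]
      simpa [hχ] using h1
    exact hy (ZMod.injective_stdAddChar h2)
  exact AddChar.sum_eq_zero_iff_ne_zero.2 hne

theorem ZMod.two_ne_zero_of_ne {p : ℕ} [Fact p.Prime] (hp : p ≠ 2) : (2 : ZMod p) ≠ 0 := by
  intro h
  have h' : ((2 : ℕ) : ZMod p) = 0 := by exact_mod_cast h
  rw [ZMod.natCast_eq_zero_iff] at h'
  exact hp ((Nat.prime_dvd_prime_iff_eq Fact.out Nat.prime_two).1 h')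

section Schroedinger

variable {p : ℕ} [Fact p.Prime] {G Y : Type*} [AddCommGroup G] [Module (ZMod p) G]
  [AddCommGroup Y] [Module (ZMod p) Y] [Fintype Y] [DecidableEq Y]

/-- The operator which shifts by `a u` and multiplies by the character `β u`. -/
noncomputable def schroedingerOp (a : G →ₗ[ZMod p] Y) (β : G →ₗ[ZMod p] Y →ₗ[ZMod p] ZMod p)
    (u : G) : Matrix Y Y ℂ :=
  -- The half phase (p is odd) makes the multiplier symmetric, ω / 2, and the adjoint of the
  -- operator of u exactly that of -u.
  fun y y' => if y = y' + a u then ZMod.stdAddChar (β u y' + 2⁻¹ * β u (a u)) else 0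

theorem schroedingerOp_mul_apply (a : G →ₗ[ZMod p] Y) (β : G →ₗ[ZMod p] Y →ₗ[ZMod p] ZMod p)
    (u : G) (M : Matrix Y Y ℂ) (y y' : Y) : (schroedingerOp a β u * M) y y' =
      ZMod.stdAddChar (β u (y - a u) + 2⁻¹ * β u (a u)) * M (y - a u) y' := by
  rw [Matrix.mul_apply, Finset.sum_eq_single (y - a u)]
  · simp [schroedingerOp]
  · intro b _ hb
    rw [schroedingerOp, if_neg, zero_mul]
    rintro rfl
    simp at hb
  · simp

theorem mul_schroedingerOp_apply (a : G →ₗ[ZMod p] Y) (β : G →ₗ[ZMod p] Y →ₗ[ZMod p] ZMod p)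
    (u : G) (M : Matrix Y Y ℂ) (y y' : Y) : (M * schroedingerOp a β u) y y' =
      M y (y' + a u) * ZMod.stdAddChar (β u y' + 2⁻¹ * β u (a u)) := by
  rw [Matrix.mul_apply, Finset.sum_eq_single (y' + a u)]
  · simp [schroedingerOp]
  · intro b _ hb
    rw [schroedingerOp, if_neg hb, mul_zero]
  · simp

/-- The Schrödinger representation. -/
noncomputable def schroedingerSystem (hp : p ≠ 2) (ω : G →ₗ[ZMod p] G →ₗ[ZMod p] ZMod p)
    (a : G →ₗ[ZMod p] Y) (β : G →ₗ[ZMod p] Y →ₗ[ZMod p] ZMod p)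
    (hω : ∀ u v, ω u v = β u (a v) - β v (a u)) (h0 : ∀ u, a u = 0 → β u = 0 → u = 0) :
    WeylSystem p ω Y where
  op := schroedingerOp a β
  op_zero := by
    ext y y'
    simp [schroedingerOp, Matrix.one_apply]
  op_mul u v := by
    have h2 := ZMod.two_ne_zero_of_ne hp
    ext y y'
    rw [mul_schroedingerOp_apply, Matrix.smul_apply, smul_eq_mul]
    unfold schroedingerOp
    have hc : y = y' + a v + a u ↔ y = y' + a (u + v) := by
      rw [map_add, add_assoc, add_comm (a v)]
    by_cases h : y = y' + a (u + v)
    · rw [if_pos h, if_pos (hc.2 h), ← AddChar.map_add_eq_mul, ← AddChar.map_add_eq_mul, hω]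
      congr 1
      simp only [map_add, LinearMap.add_apply]
      linear_combination (β u (a v)) * (inv_mul_cancel₀ h2).symm
    · rw [if_neg h, if_neg (hc.not.2 h)]
      simp
  op_adj u := by
    ext y y'
    rw [Matrix.conjTranspose_apply]
    unfold schroedingerOp
    have hc : y' = y + a u ↔ y = y' + a (-u) := by
      rw [map_neg, ← sub_eq_add_neg, eq_sub_iff_add_eq, eq_comm]
    by_cases h : y' = y + a u
    · rw [if_pos h, if_pos (hc.1 h), ← starRingEnd_apply, ← AddChar.map_neg_eq_conj]
      congr 1
      subst h
      have h2 := ZMod.two_ne_zero_of_ne hp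
      simp only [map_add, map_neg, LinearMap.neg_apply]
      linear_combination (-β u (a u)) * (inv_mul_cancel₀ h2)
    · rw [if_neg h, if_neg (hc.not.1 h)]
      simp
  op_trace u hu := by
    by_cases ha : a u = 0
    · have hb : β u ≠ 0 := fun hb => hu (h0 u ha hb)
      obtain ⟨y, hy⟩ : ∃ y, β u y ≠ 0 := by
        by_contra! h
        exact hb (LinearMap.ext h)
      simpa [Matrix.trace, schroedingerOp, ha] using AddChar.sum_comp_linearMap_eq_zero (β u) hy
    · simp [Matrix.trace, schroedingerOp, ha]

end Schroedinger

/-- Relabelling of the basis. -/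
noncomputable def WeylSystem.reindex {p : ℕ} [Fact p.Prime] {G : Type*} [AddCommGroup G]
    [Module (ZMod p) G]
    {ω : G →ₗ[ZMod p] G →ₗ[ZMod p] ZMod p} {I J : Type*} [Fintype I] [DecidableEq I] [Fintype J]
    [DecidableEq J] (W : WeylSystem p ω I) (e : J ≃ I) : WeylSystem p ω J where
  op u := (W.op u).submatrix e e
  op_zero := by rw [W.op_zero, Matrix.submatrix_one_equiv]
  op_mul u v := by rw [Matrix.submatrix_mul_equiv, W.op_mul, Matrix.submatrix_smul]; rfl
  op_adj u := by rw [Matrix.conjTranspose_submatrix, W.op_adj]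
  op_trace u hu := by
    rw [← W.op_trace u hu]
    exact Equiv.sum_comp e (fun i => W.op u i i)

namespace WeylSystem

variable {p : ℕ} [Fact p.Prime] {G : Type*} [AddCommGroup G] [Module (ZMod p) G]
  {ω : G →ₗ[ZMod p] G →ₗ[ZMod p] ZMod p} {I : Type*} [Fintype I] [DecidableEq I]
  (W : WeylSystem p ω I)

theorem op_trace_mul (u v : G) [DecidableEq G] :
    (W.op (-u) * W.op v).trace = if u = v then (Fintype.card I : ℂ) *
      ZMod.stdAddChar (2⁻¹ * ω (-u) v) else 0 := by
  rw [W.op_mul, Matrix.trace_smul]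
  by_cases h : u = v
  · subst h
    simp [W.op_zero, mul_comm]
  · rw [W.op_trace _ (by rwa [neg_add_eq_sub, sub_ne_zero, ne_comm]), if_neg h, smul_zero]

/-- Weyl operators are orthogonal for the trace form, so this trace reads off a coefficient; linear
independence and the vanishing of coefficients below both rest on it. -/
theorem trace_sum [Fintype G] [Nonempty I] (hω : ω.IsAlt) (f : G → ℂ) (u : G) :
    (W.op (-u) * ∑ v, f v • W.op v).trace = Fintype.card I * f u := by
  classical
  rw [Finset.mul_sum, Matrix.trace_sum, Finset.sum_eq_single u]
  · rw [Matrix.mul_smul, Matrix.trace_smul, op_trace_mul, if_pos rfl]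
    simp [hω u, mul_comm]
  · intro v _ hv
    rw [Matrix.mul_smul, Matrix.trace_smul, op_trace_mul, if_neg hv.symm, smul_zero]
  · simp

/-- The Weyl operators are a basis of the space of matrices. -/
theorem exists_sum [Fintype G] [Nonempty I] (hω : ω.IsAlt)
    (hcard : Fintype.card G = Fintype.card I ^ 2) (E : Matrix I I ℂ) :
    ∃ f : G → ℂ, E = ∑ v, f v • W.op v := by
  have hli : LinearIndependent ℂ W.op := by
    rw [Fintype.linearIndependent_iff]
    intro f hf u
    have := W.trace_sum hω f u
    rw [hf, Matrix.mul_zero, Matrix.trace_zero] at this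
    simpa using this.symm
  have hspan : Submodule.span ℂ (Set.range W.op) = ⊤ := by
    apply hli.span_eq_top_of_card_eq_finrank'
    rw [hcard, Module.finrank_matrix]
    simp [sq]
  have hE : E ∈ Submodule.span ℂ (Set.range W.op) := hspan ▸ Submodule.mem_top
  obtain ⟨f, hf⟩ := (Submodule.mem_span_range_iff_exists_fun ℂ).1 hE
  exact ⟨f, hf.symm⟩

theorem op_mul_op_neg (hω : ω.IsAlt) (u : G) : W.op u * W.op (-u) = 1 := by
  simp [W.op_mul, W.op_zero, hω u]

theorem op_neg_mul_op (hω : ω.IsAlt) (u : G) : W.op (-u) * W.op u = 1 := by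
  simp [W.op_mul, W.op_zero, hω u]

theorem op_comm (hp : p ≠ 2) (hω : ω.IsAlt) (u v : G) :
    W.op u * W.op v = ZMod.stdAddChar (ω u v) • (W.op v * W.op u) := by
  have h2 := ZMod.two_ne_zero_of_ne hp
  rw [W.op_mul, W.op_mul, smul_smul, ← AddChar.map_add_eq_mul, add_comm v u]
  congr 2
  linear_combination (ω u v) * (inv_mul_cancel₀ h2) + 2⁻¹ * hω.neg u v

/-- The coefficients of an operator that commutes with `W.op u` vanish off the orthogonal space
of `u`. -/
theorem coeff_eq_zero_of_commute [Fintype G] [Nonempty I] (hp : p ≠ 2) (hω : ω.IsAlt) (f : G → ℂ)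
    {u v : G} (huv : ω u v ≠ 0) (hcomm : Commute (∑ v, f v • W.op v) (W.op u)) : f v = 0 := by
  have h1 := W.trace_sum hω f v
  set E := ∑ v, f v • W.op v
  -- Conjugation by the operator of u fixes E but multiplies that of -v by a nontrivial root of
  -- unity, so the trace must vanish.
  have h2 : (W.op (-v) * E).trace = ZMod.stdAddChar (ω u (-v)) * (W.op (-v) * E).trace := by
    calc (W.op (-v) * E).trace = (W.op (-v) * (W.op (-u) * (W.op u * E))).trace := by
          rw [← Matrix.mul_assoc (W.op (-u)), W.op_neg_mul_op hω, Matrix.one_mul]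
      _ = (W.op (-v) * (W.op (-u) * (E * W.op u))).trace := by rw [hcomm.eq]
      _ = (W.op u * W.op (-v) * W.op (-u) * E).trace := by
          rw [← Matrix.mul_assoc, ← Matrix.mul_assoc, Matrix.trace_mul_comm, ← Matrix.mul_assoc,
            ← Matrix.mul_assoc]
      _ = _ := by
          rw [W.op_comm hp hω u (-v), Matrix.smul_mul, Matrix.mul_assoc (W.op (-v)),
            W.op_mul_op_neg hω, Matrix.mul_one, Matrix.smul_mul, Matrix.trace_smul, smul_eq_mul]
  have h3 : ZMod.stdAddChar (ω u (-v)) ≠ 1 := by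
    rw [← AddChar.map_zero_eq_one (ZMod.stdAddChar (N := p))]
    intro h
    have := ZMod.injective_stdAddChar h
    simp [huv] at this
  have h4 : (W.op (-v) * E).trace = 0 := by
    have : (1 - ZMod.stdAddChar (ω u (-v))) * (W.op (-v) * E).trace = 0 := by
      linear_combination h2
    rcases mul_eq_zero.1 this with h | h
    · exact absurd (sub_eq_zero.1 h).symm h3
    · exact h
  rw [h1] at h4
  simpa using h4

end WeylSystem

/-! ### Stabilizer states and their expectation values -/

namespace WeylSystem

variable {p : ℕ} [Fact p.Prime] {G : Type*} [AddCommGroup G] [Module (ZMod p) G]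
  {ω : G →ₗ[ZMod p] G →ₗ[ZMod p] ZMod p} {I : Type*} [Fintype I] [DecidableEq I]
  (W : WeylSystem p ω I)

/-- An isotropic subspace stabilizes a unit vector. -/
theorem exists_fixed_vector [Fintype G] [Nonempty I] (Z : Submodule (ZMod p) G)
    (hZ : ∀ z ∈ Z, ∀ z' ∈ Z, ω z z' = 0) :
    ∃ φ : I → ℂ, star φ ⬝ᵥ φ = 1 ∧ ∀ z ∈ Z, (W.op z).mulVec φ = φ := by
  classical
  -- On an isotropic space the operators multiply without phases, so P absorbs each of them. Its
  -- trace comes from z = 0 alone, hence P ≠ 0 and any nonzero column is a fixed vector.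
  set P : Matrix I I ℂ := ∑ z : Z, W.op z with hP
  have htr : P.trace = Fintype.card I := by
    rw [hP, Matrix.trace_sum, Finset.sum_eq_single 0]
    · simp [W.op_zero]
    · intro z _ hz
      exact W.op_trace _ (by simpa using hz)
    · simp
  have hfix : ∀ z ∈ Z, W.op z * P = P := by
    intro z hz
    rw [hP, Finset.mul_sum, ← Equiv.sum_comp (Equiv.addLeft (⟨z, hz⟩ : Z)) (fun z : Z => W.op z)]
    refine Finset.sum_congr rfl fun z' _ => ?_
    rw [W.op_mul, hZ z hz z' z'.2]
    simp
  have hP0 : P ≠ 0 := by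
    intro h
    rw [h, Matrix.trace_zero] at htr
    exact Nat.cast_ne_zero.2 Fintype.card_ne_zero htr.symm
  obtain ⟨j, hj⟩ : ∃ j, P.col j ≠ 0 := by
    by_contra! h
    exact hP0 (Matrix.ext fun i j => congrFun (h j) i)
  set φ := P.col j with hφ
  have hφfix : ∀ z ∈ Z, (W.op z).mulVec φ = φ := by
    intro z hz
    have := congrArg (fun M : Matrix I I ℂ => M.col j) (hfix z hz)
    exact this
  set t : ℝ := ∑ i, ‖φ i‖ ^ 2 with ht
  have hdot : star φ ⬝ᵥ φ = (t : ℂ) := by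
    simp [dotProduct, ht, ← Complex.conj_mul']
  have ht0 : 0 < t := by
    obtain ⟨i, hi⟩ := Function.ne_iff.1 hj
    exact Finset.sum_pos' (fun i _ => by positivity) ⟨i, Finset.mem_univ _, by
      have : 0 < ‖φ i‖ := norm_pos_iff.2 hi
      positivity⟩
  refine ⟨((Real.sqrt t)⁻¹ : ℂ) • φ, ?_, fun z hz => by rw [Matrix.mulVec_smul, hφfix z hz]⟩
  rw [star_smul, smul_dotProduct, dotProduct_smul, hdot]
  have hs : ((Real.sqrt t : ℝ) : ℂ) * (Real.sqrt t : ℝ) = t := by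
    rw [← Complex.ofReal_mul, Real.mul_self_sqrt ht0.le]
  have hs0 : ((Real.sqrt t : ℝ) : ℂ) ≠ 0 := by
    exact_mod_cast (Real.sqrt_pos.2 ht0).ne'
  simp only [star_inv₀, RCLike.star_def, Complex.conj_ofReal, smul_eq_mul]
  rw [← hs]
  field_simp

/-- The expectation value of a Weyl operator in the state `φ`. -/
noncomputable def expect (φ : I → ℂ) (u : G) : ℂ := star φ ⬝ᵥ (W.op u).mulVec φ

theorem expect_eq_one {φ : I → ℂ} (hφ : star φ ⬝ᵥ φ = 1) {u : G}
    (hu : (W.op u).mulVec φ = φ) : W.expect φ u = 1 := by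
  rw [expect, hu, hφ]

theorem star_op_mulVec_dotProduct (φ ψ : I → ℂ) (u : G) :
    star ((W.op u).mulVec φ) ⬝ᵥ ψ = star φ ⬝ᵥ (W.op (-u)).mulVec ψ := by
  rw [Matrix.star_mulVec, W.op_adj, Matrix.dotProduct_mulVec]

/-- The operator of z fixes φ, so conjugating by it leaves the expectation value unchanged, yet it
multiplies the operator of u by a root of unity other than 1. -/
theorem expect_eq_zero (hp : p ≠ 2) (hω : ω.IsAlt) {φ : I → ℂ} {u z : G}
    (hz : (W.op z).mulVec φ = φ) (hzu : ω z u ≠ 0) : W.expect φ u = 0 := by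
  have h1 : W.expect φ u = ZMod.stdAddChar (ω (-z) u) * W.expect φ u := by
    calc W.expect φ u = star ((W.op z).mulVec φ) ⬝ᵥ (W.op u).mulVec φ := by rw [hz]; rfl
      _ = star φ ⬝ᵥ (W.op (-z) * W.op u * W.op z).mulVec φ := by
          rw [star_op_mulVec_dotProduct, Matrix.mulVec_mulVec, ← Matrix.mulVec_mulVec _ _ (W.op z),
            hz]
      _ = ZMod.stdAddChar (ω (-z) u) * W.expect φ u := by
          rw [W.op_comm hp hω, Matrix.smul_mul, Matrix.mul_assoc, W.op_neg_mul_op hω,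
            Matrix.mul_one, Matrix.smul_mulVec, dotProduct_smul, expect, smul_eq_mul]
  have h3 : ZMod.stdAddChar (ω (-z) u) ≠ 1 := by
    rw [← AddChar.map_zero_eq_one (ZMod.stdAddChar (N := p))]
    intro h
    have := ZMod.injective_stdAddChar h
    simp [hzu] at this
  have h4 : (1 - ZMod.stdAddChar (ω (-z) u)) * W.expect φ u = 0 := by
    linear_combination h1
  exact (mul_eq_zero.1 h4).resolve_left fun h => h3 (sub_eq_zero.1 h).symm

/-- For commuting shifts x, x' this reduces every matrix element between encoded basis states to a
phase and one expectation value. -/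
theorem matrixElement_eq (hω : ω.IsAlt) (φ : I → ℂ) {x x' : G} (hxx' : ω x x' = 0) (w : G) :
    star ((W.op x).mulVec φ) ⬝ᵥ (W.op w).mulVec ((W.op x').mulVec φ) =
      ZMod.stdAddChar (2⁻¹ * (ω w x + ω w x')) * W.expect φ (w + x' - x) := by
  rw [star_op_mulVec_dotProduct, Matrix.mulVec_mulVec, Matrix.mulVec_mulVec, W.op_mul,
    Matrix.smul_mul, W.op_mul, smul_smul, Matrix.smul_mulVec, dotProduct_smul, smul_eq_mul,
    ← AddChar.map_add_eq_mul, expect, add_assoc]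
  congr 2
  · simp only [map_add, LinearMap.add_apply, map_neg, LinearMap.neg_apply, hxx']
    linear_combination 2⁻¹ * hω.neg x w
  · rw [neg_add_eq_sub]

end WeylSystem

/-! ### Entanglement-assisted codes from stabilizer data -/

/-- The identity on the receiver's side forces equal labels b on both sides, so compression to the
code averages the encoder's matrix over b. -/
theorem EACode.compress_apply {q n k c : ℕ} (Q : EACode q n k c)
    (E : Matrix (Fin n → Fin q) (Fin n → Fin q) ℂ) (x x' : Fin k → Fin q) :
    (Q.encode.conjTranspose *
      Matrix.kronecker E (1 : Matrix (Fin c → Fin q) (Fin c → Fin q) ℂ) * Q.encode) x x' =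
      ((q : ℂ) ^ c)⁻¹ * ∑ b, (Q.encoder.conjTranspose * E * Q.encoder) (x, b) (x', b) := by
  have hs : (((Real.sqrt ((q : ℝ) ^ c))⁻¹ : ℝ) : ℂ) * (((Real.sqrt ((q : ℝ) ^ c))⁻¹ : ℝ) : ℂ) =
      ((q : ℂ) ^ c)⁻¹ := by
    rw [← Complex.ofReal_mul, ← mul_inv, Real.mul_self_sqrt (by positivity)]
    push_cast
    rfl
  rw [← hs]
  simp only [Matrix.mul_apply, Matrix.conjTranspose_apply, EACode.encode, Fintype.sum_prod_type,
    Matrix.kronecker, Matrix.kroneckerMap_apply, Matrix.one_apply, mul_ite, mul_one, mul_zero,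
    Finset.sum_ite_eq', Finset.mem_univ, if_true]
  rw [Finset.sum_comm, Finset.mul_sum]
  refine Finset.sum_congr rfl fun b _ => ?_
  rw [Finset.mul_sum]
  refine Finset.sum_congr rfl fun y _ => ?_
  rw [Finset.sum_mul, Finset.sum_mul, Finset.mul_sum]
  refine Finset.sum_congr rfl fun y' _ => ?_
  simp only [star_mul', RCLike.star_def, Complex.conj_ofReal]
  ring

section Encoder

variable {p : ℕ} [Fact p.Prime] {G : Type*} [AddCommGroup G] [Module (ZMod p) G] [Fintype G]
  {ω : G →ₗ[ZMod p] G →ₗ[ZMod p] ZMod p} {q n k c : ℕ}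
  {A B : Type*} [AddCommGroup A] [Module (ZMod p) A] [AddCommGroup B] [Module (ZMod p) B]

/-- An entanglement-assisted code from logical shift operators `XA`, `XB` and an isotropic space
`Z` of Weyl operators. -/
theorem WeylSystem.exists_eaCode (W : WeylSystem p ω (Fin n → Fin q)) (hq : q ≠ 0)
    (hp : p ≠ 2) (hω : ω.IsAlt) (Z : Submodule (ZMod p) G)
    (hZ : ∀ z ∈ Z, ∀ z' ∈ Z, ω z z' = 0) (XA : A →ₗ[ZMod p] G) (XB : B →ₗ[ZMod p] G)
    (hAA : ∀ a a', ω (XA a) (XA a') = 0) (hAB : ∀ a b, ω (XA a) (XB b) = 0)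
    (hBB : ∀ b b', ω (XB b) (XB b') = 0)
    (hX : ∀ a b, (a ≠ 0 ∨ b ≠ 0) → ∃ z ∈ Z, ω z (XA a + XB b) ≠ 0)
    (ek : (Fin k → Fin q) ≃ A) (ec : (Fin c → Fin q) ≃ B) :
    ∃ Q : EACode q n k c,
      (∀ w, ((∃ z ∈ Z, (∀ a, ω z (XA a) = 0) ∧ ω z w ≠ 0) ∨ ∃ b, ω w (XB b) ≠ 0) →
        Q.Detects (W.op w)) ∧
      (∀ w, (∀ b, ω w (XB b) = 0) →
        ((∃ a, a ≠ 0 ∧ w - XA a ∈ Z) ∨ (w ∈ Z ∧ ∃ a, ω w (XA a) ≠ 0)) →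
        ¬ Q.Detects (W.op w)) := by
  have : NeZero q := ⟨hq⟩
  obtain ⟨φ, hφ1, hφ⟩ := W.exists_fixed_vector Z hZ
  have hBA : ∀ b a, ω (XB b) (XA a) = 0 := fun b a => by rw [← hω.neg, hAB, neg_zero]
  let X : (Fin k → Fin q) × (Fin c → Fin q) → G := fun m => XA (ek m.1) + XB (ec m.2)
  have hXX : ∀ m m', ω (X m) (X m') = 0 := by
    intro m m'
    simp [X, hAA, hAB, hBB, hBA]
  let V : Matrix (Fin n → Fin q) ((Fin k → Fin q) × (Fin c → Fin q)) ℂ :=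
    fun i m => (W.op (X m)).mulVec φ i
  have hV : ∀ w m m', (V.conjTranspose * W.op w * V) m m' =
      ZMod.stdAddChar (2⁻¹ * (ω w (X m) + ω w (X m'))) * W.expect φ (w + X m' - X m) := by
    intro w m m'
    rw [← W.matrixElement_eq hω φ (hXX m m') w, Matrix.mul_assoc]
    rfl
  have hiso : V.conjTranspose * V = 1 := by
    ext m m'
    have h := hV 0 m m'
    rw [W.op_zero, Matrix.mul_one] at h
    rw [h]
    by_cases hmm : m = m'
    · subst hmm
      simp [W.expect_eq_one hφ1 (hφ 0 Z.zero_mem)]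
    · rw [Matrix.one_apply_ne hmm]
      -- Distinct labels give shifts that some stabilizer in Z tells apart, so the two basis states
      -- are orthogonal.
      obtain ⟨z, hz, hzX⟩ := hX (ek m'.1 - ek m.1) (ec m'.2 - ec m.2) (by
        by_contra! h0
        simp only [sub_eq_zero, EmbeddingLike.apply_eq_iff_eq] at h0
        exact hmm (Prod.ext h0.1.symm h0.2.symm))
      rw [W.expect_eq_zero hp hω (hφ z hz), mul_zero]
      convert hzX using 2
      simp only [X, map_sub]
      abel
  let Q : EACode q n k c := ⟨V, hiso⟩
  have hXb : ∀ x x' b, X (x', b) - X (x, b) = XA (ek x' - ek x) := by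
    intro x x' b
    simp [X]
  have hcomp : ∀ w x x', (Q.encode.conjTranspose *
      Matrix.kronecker (W.op w) (1 : Matrix (Fin c → Fin q) (Fin c → Fin q) ℂ) * Q.encode) x x' =
      ((q : ℂ) ^ c)⁻¹ * ((∑ b, ZMod.stdAddChar (2⁻¹ * (ω w (X (x, b)) + ω w (X (x', b))))) *
        W.expect φ (w + XA (ek x' - ek x))) := by
    intro w x x'
    rw [Q.compress_apply, Finset.sum_mul]
    congr 1
    refine Finset.sum_congr rfl fun b _ => ?_
    rw [← hXb x x' b, ← add_sub_assoc]
    exact hV w (x, b) (x', b)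
  have hphase : ∀ w x x' b, 2⁻¹ * (ω w (X (x, b)) + ω w (X (x', b))) =
      2⁻¹ * ω w (XA (ek x + ek x')) + ω w (XB (ec b)) := by
    intro w x x' b
    simp only [X, map_add]
    linear_combination (ω w (XB (ec b))) * inv_mul_cancel₀ (ZMod.two_ne_zero_of_ne hp)
  have hqc : ((q : ℂ) ^ c)⁻¹ * (Fintype.card (Fin c → Fin q) : ℂ) = 1 := by
    rw [Fintype.card_fun, Fintype.card_fin, Fintype.card_fin, Nat.cast_pow]
    exact inv_mul_cancel₀ (pow_ne_zero _ (Nat.cast_ne_zero.2 hq))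
  refine ⟨Q, fun w hw => ⟨0, ?_⟩, fun w hwB hw => ?_⟩
  · ext x x'
    rw [hcomp, zero_smul, Matrix.zero_apply]
    rcases hw with ⟨z, hz, hzA, hzw⟩ | ⟨b, hb⟩
    · rw [W.expect_eq_zero hp hω (hφ z hz), mul_zero, mul_zero]
      simpa [hzA] using hzw
    -- Here detection comes from the entanglement: the phases over b form a nontrivial character
    -- sum, which is zero.
    · simp only [hphase, AddChar.map_add_eq_mul]
      let _ := Fintype.ofEquiv _ ec
      rw [← Finset.mul_sum, Equiv.sum_comp ec (fun b => ZMod.stdAddChar (ω w (XB b)))]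
      have := AddChar.sum_comp_linearMap_eq_zero ((ω w).comp XB) hb
      simp only [LinearMap.comp_apply] at this
      rw [this]
      simp
  · rintro ⟨t, ht⟩
    have hent : ∀ x x', ZMod.stdAddChar (2⁻¹ * ω w (XA (ek x + ek x'))) *
        W.expect φ (w + XA (ek x' - ek x)) = if x = x' then t else 0 := by
      intro x x'
      have h := congrFun (congrFun ht x) x'
      rw [hcomp] at h
      simp only [hphase, hwB, add_zero, Finset.sum_const, Finset.card_univ, nsmul_eq_mul] at h
      rw [mul_assoc, ← mul_assoc, hqc, one_mul] at h
      simpa [Matrix.one_apply] using h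
    -- Either the error moves the message by a, giving a nonzero off-diagonal entry, or it acts
    -- diagonally with unequal phases at 0 and at some a. Neither is a scalar.
    rcases hw with ⟨a, ha, hwa⟩ | ⟨hwZ, a, ha⟩
    · have h := hent (ek.symm a) (ek.symm 0)
      rw [if_neg (by simpa using ha), Equiv.apply_symm_apply, Equiv.apply_symm_apply, zero_sub,
        map_neg, ← sub_eq_add_neg, W.expect_eq_one hφ1 (hφ _ hwa), mul_one] at h
      exact (AddChar.val_isUnit _ _).ne_zero h
    · have h0 := hent (ek.symm 0) (ek.symm 0)
      have h1 := hent (ek.symm a) (ek.symm a)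
      rw [if_pos rfl, Equiv.apply_symm_apply, sub_self, map_zero, add_zero,
        W.expect_eq_one hφ1 (hφ _ hwZ), mul_one, ← h0.trans (if_pos rfl)] at h1
      rw [Equiv.apply_symm_apply, sub_self, map_zero, add_zero, add_zero,
        W.expect_eq_one hφ1 (hφ _ hwZ), mul_one] at h1
      have h2 := ZMod.injective_stdAddChar h1
      refine ha ?_
      simp only [map_add, map_zero, mul_zero] at h2
      linear_combination h2 - (ω w (XA a)) * inv_mul_cancel₀ (ZMod.two_ne_zero_of_ne hp)

end Encoder

/-! ### Local Weyl operators -/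

/-- The form on `Fin n → F` that a form on `F` induces coordinatewise. -/
def piForm {k F : Type*} [Field k] [AddCommGroup F] [Module k F] (n : ℕ)
    (τ : F →ₗ[k] F →ₗ[k] k) : (Fin n → F) →ₗ[k] (Fin n → F) →ₗ[k] k :=
  ∑ i, (τ.compl₁₂ (LinearMap.proj i) (LinearMap.proj i))

theorem piForm_apply {k F : Type*} [Field k] [AddCommGroup F] [Module k F] {n : ℕ}
    (τ : F →ₗ[k] F →ₗ[k] k) (u v : Fin n → F) : piForm n τ u v = ∑ i, τ (u i) (v i) := by
  simp [piForm]

theorem piForm_isAlt {k F : Type*} [Field k] [AddCommGroup F] [Module k F] {n : ℕ}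
    {τ : F →ₗ[k] F →ₗ[k] k} (hτ : τ.IsAlt) : (piForm n τ).IsAlt := fun u => by
  simp [piForm_apply, hτ (u _)]

/-- The hypotheses treat the two factors of the operator separately: E is invariant under the shift
by `a u`, and it connects only basis states on which the character of u agrees. -/
theorem schroedingerOp_commute_of_local {p : ℕ} [Fact p.Prime] {G Y : Type*} [AddCommGroup G]
    [Module (ZMod p) G] [AddCommGroup Y] [Module (ZMod p) Y] [Fintype Y] [DecidableEq Y]
    (a : G →ₗ[ZMod p] Y) (β : G →ₗ[ZMod p] Y →ₗ[ZMod p] ZMod p) (u : G) (E : Matrix Y Y ℂ)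
    (hE : ∀ y y', E (y - a u) y' = E y (y' + a u))
    (hβ : ∀ y y', E y y' ≠ 0 → β u y = β u y') : Commute E (schroedingerOp a β u) := by
  ext y y'
  rw [schroedingerOp_mul_apply, mul_schroedingerOp_apply, hE, mul_comm]
  by_cases h : E y (y' + a u) = 0
  · simp [h]
  · rw [map_sub, hβ _ _ h]
    simp

/-- Weyl operators on `n` qudits, with errors on a set of qudits expanded in the operators
supported there. -/
theorem exists_local_weylSystem {p q : ℕ} [Fact p.Prime] (hp : p ≠ 2) {F : Type*} [AddCommGroup F]
    [Module (ZMod p) F] [Fintype F] [DecidableEq F] (hF : Fintype.card F = q ^ 2)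
    {τ : F →ₗ[ZMod p] F →ₗ[ZMod p] ZMod p} (hτ : τ.IsAlt) (hnd : ∀ u, (∀ v, τ u v = 0) → u = 0)
    (n : ℕ) :
    ∃ W : WeylSystem p (piForm n τ) (Fin n → Fin q),
      (∀ (S : Finset (Fin n)) (w : Fin n → F), (∀ i, i ∉ S → w i = 0) → ActsOn S (W.op w)) ∧
      (∀ (S : Finset (Fin n)) (E : Matrix (Fin n → Fin q) (Fin n → Fin q) ℂ), ActsOn S E →
        ∀ u : Fin n → F, (∀ i ∈ S, u i = 0) → Commute E (W.op u)) := by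
  obtain ⟨m, x, z, h, hrad, hdim⟩ := exists_isHyperbolic hτ
  have hker : LinearMap.ker τ = ⊥ := by
    rw [LinearMap.ker_eq_bot']
    exact fun u hu => hnd u fun v => by rw [hu]; rfl
  rw [hker, finrank_bot, zero_add] at hdim
  have hcard := Module.card_eq_pow_finrank (K := ZMod p) (V := F)
  rw [hF, hdim, ZMod.card, mul_comm, pow_mul] at hcard
  have hqm : q = p ^ m := Nat.pow_left_injective two_ne_zero hcard
  have hε : Fintype.card (Fin q) = Fintype.card (Fin m → ZMod p) := by
    simp [hqm]
  let ε : Fin q ≃ (Fin m → ZMod p) := Fintype.equivOfCardEq hε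
  let a₁ : F →ₗ[ZMod p] (Fin m → ZMod p) := LinearMap.pi fun j => τ.flip (z j)
  let b₁ : F →ₗ[ZMod p] (Fin m → ZMod p) := LinearMap.pi fun j => τ.flip (x j)
  -- In hyperbolic coordinates τ becomes the standard form, so each qudit carries a Schrödinger
  -- representation on functions of m variables, where q = p^m.
  have hτ₁ : ∀ u v, τ u v = b₁ u ⬝ᵥ a₁ v - b₁ v ⬝ᵥ a₁ u := by
    intro u v
    have hu : u = hyperbolicSum x z (a₁ u) (b₁ u) := by
      rw [← sub_eq_zero]
      refine hnd _ (hrad _ ?_)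
      rw [map_sub, h.pairing_left hτ]
      exact sub_self _
    have : τ u v = τ (hyperbolicSum x z (a₁ u) (b₁ u)) v := by rw [← hu]
    rw [this]
    have hx : ∀ j, τ (x j) v = -b₁ v j := fun j => (hτ.neg v (x j)).symm
    have hz : ∀ j, τ (z j) v = -a₁ v j := fun j => (hτ.neg v (z j)).symm
    simp only [hyperbolicSum, map_sum, map_sub, map_smul, LinearMap.sum_apply, LinearMap.sub_apply,
      LinearMap.smul_apply, smul_eq_mul, hx, hz, dotProduct, ← Finset.sum_sub_distrib]
    refine Finset.sum_congr rfl fun j _ => ?_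
    ring
  have h0₁ : ∀ u, a₁ u = 0 → b₁ u = 0 → u = 0 := by
    intro u ha hb
    exact hnd u fun v => by rw [hτ₁, ha, hb]; simp
  let a : (Fin n → F) →ₗ[ZMod p] (Fin n → Fin m → ZMod p) :=
    LinearMap.pi fun i => a₁.comp (LinearMap.proj i)
  let β : (Fin n → F) →ₗ[ZMod p] (Fin n → Fin m → ZMod p) →ₗ[ZMod p] ZMod p :=
    LinearMap.mk₂ _ (fun u y => ∑ i, b₁ (u i) ⬝ᵥ y i)
      (fun u u' y => by simp [add_dotProduct, Finset.sum_add_distrib])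
      (fun t u y => by simp [Finset.mul_sum])
      (fun u y y' => by simp [dotProduct_add, Finset.sum_add_distrib])
      (fun t u y => by simp [Finset.mul_sum])
  have hβ : ∀ u y, β u y = ∑ i, b₁ (u i) ⬝ᵥ y i := fun u y => rfl
  have ha : ∀ u i, a u i = a₁ (u i) := fun u i => rfl
  have hω : ∀ u v, piForm n τ u v = β u (a v) - β v (a u) := by
    intro u v
    rw [piForm_apply, hβ, hβ, ← Finset.sum_sub_distrib]
    exact Finset.sum_congr rfl fun i _ => hτ₁ _ _
  have h0 : ∀ u, a u = 0 → β u = 0 → u = 0 := by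
    intro u hau hbu
    funext i
    refine h0₁ _ (congrFun hau i) ?_
    funext j
    have := LinearMap.congr_fun hbu (Pi.single i (Pi.single j 1))
    rw [hβ, Finset.sum_eq_single i] at this
    · simpa using this
    · intro i' _ hi'
      simp [hi']
    · simp
  let e : (Fin n → Fin q) ≃ (Fin n → Fin m → ZMod p) := Equiv.piCongrRight fun _ => ε
  have he : ∀ y i, e y i = ε (y i) := fun y i => rfl
  refine ⟨(schroedingerSystem hp _ a β hω h0).reindex e, ?_, ?_⟩
  · intro S w hw
    refine ⟨fun s t => if ∀ i : S, ε (s i) = ε (t i) + a₁ (w i) then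
      ZMod.stdAddChar ((∑ i : S, b₁ (w i) ⬝ᵥ ε (t i)) + 2⁻¹ * β w (a w)) else 0,
      fun y y' => ⟨fun hyy' => ?_, fun hyy' => ?_⟩⟩
    · have hc : e y = e y' + a w ↔ ∀ i : S, ε (y i) = ε (y' i) + a₁ (w i) := by
        rw [funext_iff]
        refine ⟨fun h i => h i, fun h i => ?_⟩
        by_cases hi : i ∈ S
        · exact h ⟨i, hi⟩
        · rw [Pi.add_apply, he, he, ha, hw i hi, hyy' i hi, map_zero, add_zero]
      have hs : β w (e y') = ∑ i : S, b₁ (w i) ⬝ᵥ ε (y' i) := by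
        rw [hβ, Finset.sum_coe_sort S (fun i => b₁ (w i) ⬝ᵥ ε (y' i))]
        symm
        refine Finset.sum_subset (Finset.subset_univ _) fun i _ hi => ?_
        simp [hw i hi]
      change schroedingerOp a β w (e y) (e y') = _
      simp only [schroedingerOp, hc, hs]
    · change schroedingerOp a β w (e y) (e y') = _
      rw [schroedingerOp, if_neg]
      intro hc
      refine hyy' fun i hi => ε.injective ?_
      have := congrFun hc i
      rwa [Pi.add_apply, he, he, ha, hw i hi, map_zero, add_zero] at this
  · rintro S E ⟨E₁, hE₁⟩ u hu
    let E' := E.submatrix e.symm e.symm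
    have hEE : E = E'.submatrix e e := by
      ext y y'
      simp [E']
    have hE' : ∀ y y', E' y y' = if ∀ i, i ∉ S → y i = y' i then
        E₁ (fun i => ε.symm (y i)) (fun i => ε.symm (y' i)) else 0 := by
      intro y y'
      have hc : (∀ i, i ∉ S → e.symm y i = e.symm y' i) ↔ ∀ i, i ∉ S → y i = y' i :=
        forall₂_congr fun i _ => ε.symm.injective.eq_iff
      split_ifs with hyy'
      · exact (hE₁ _ _).1 (hc.2 hyy')
      · exact (hE₁ _ _).2 (hc.not.2 hyy')
    have hcomm : Commute E' (schroedingerOp a β u) := by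
      apply schroedingerOp_commute_of_local
      · intro y y'
        have hS : ∀ i : S, a u i = 0 := fun i => by rw [ha, hu i i.2, map_zero]
        simp only [hE', Pi.sub_apply, Pi.add_apply, sub_eq_iff_eq_add, hS, sub_zero, add_zero]
      · intro y y' hyy'
        rw [hE', ne_eq, ite_eq_right_iff, Classical.not_imp] at hyy'
        rw [hβ, hβ]
        refine Finset.sum_congr rfl fun i _ => ?_
        by_cases hi : i ∈ S
        · simp [hu i hi]
        · rw [hyy'.1 i hi]
    change E * (schroedingerOp a β u).submatrix e e = (schroedingerOp a β u).submatrix e e * E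
    rw [hEE, Matrix.submatrix_mul_equiv, Matrix.submatrix_mul_equiv, hcomm.eq]

/-! ### Codes from Hermitian dual pairs -/

/-- A hyperbolic family in a subspace `U` that spans it modulo its radical. -/
theorem exists_isHyperbolic_submodule {k V : Type*} [Field k] [AddCommGroup V] [Module k V]
    [FiniteDimensional k V] {ω : V →ₗ[k] V →ₗ[k] k} (hω : ω.IsAlt) (U U' : Submodule k V)
    (hU : ∀ u ∈ U, u ∈ U' ↔ ∀ v ∈ U, ω u v = 0) :
    ∃ (m : ℕ) (x z : Fin m → V), (∀ i, x i ∈ U) ∧ (∀ i, z i ∈ U) ∧ IsHyperbolic ω x z ∧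
      (∀ v ∈ U, v - hyperbolicSum x z (fun i => ω v (z i)) (fun i => ω v (x i)) ∈ U ⊓ U') ∧
      Module.finrank k U = Module.finrank k (U ⊓ U' : Submodule k V) + 2 * m := by
  set ω' : U →ₗ[k] U →ₗ[k] k := ω.compl₁₂ U.subtype U.subtype with hω'
  have happ : ∀ u v : U, ω' u v = ω u v := fun u v => rfl
  have halt : ω'.IsAlt := fun u => hω u
  obtain ⟨m, x, z, h, hrad, hdim⟩ := exists_isHyperbolic halt
  have hh : IsHyperbolic ω (fun i => (x i : V)) (fun i => (z i : V)) :=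
    ⟨fun i j => h.xx i j, fun i j => h.zz i j, fun i j => h.xz i j⟩
  refine ⟨m, fun i => x i, fun i => z i, fun i => (x i).2, fun i => (z i).2, hh, ?_, ?_⟩
  · intro v hv
    set v' : U := ⟨v, hv⟩
    set y : U := v' - hyperbolicSum x z (fun i => ω' v' (z i)) (fun i => ω' v' (x i)) with hy
    have hyV : v - hyperbolicSum (fun i => (x i : V)) (fun i => (z i : V)) (fun i => ω v (z i))
        (fun i => ω v (x i)) = (y : V) := by
      simp [hy, hyperbolicSum, happ, v']
    rw [hyV]
    refine ⟨y.2, (hU y y.2).2 fun u hu => ?_⟩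
    refine hrad y ?_ ⟨u, hu⟩
    rw [hy, map_sub, h.pairing_left halt]
    exact sub_self _
  · rw [hdim]
    congr 1
    have hmap : (LinearMap.ker ω').map U.subtype = U ⊓ U' := by
      ext u
      simp only [Submodule.mem_map, LinearMap.mem_ker, Submodule.mem_inf]
      constructor
      · rintro ⟨u, hu, rfl⟩
        refine ⟨u.2, (hU u u.2).2 fun v hv => ?_⟩
        exact LinearMap.congr_fun hu ⟨v, hv⟩
      · rintro ⟨h1, h2⟩
        exact ⟨⟨u, h1⟩, LinearMap.ext fun v => (hU u h1).1 h2 v v.2, rfl⟩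
    rw [← hmap, Submodule.finrank_map_subtype_eq]

theorem isotropic_span {k V : Type*} [Field k] [AddCommGroup V] [Module k V]
    {ω : V →ₗ[k] V →ₗ[k] k} {s : Set V} (hs : ∀ u ∈ s, ∀ v ∈ s, ω u v = 0) :
    ∀ u ∈ Submodule.span k s, ∀ v ∈ Submodule.span k s, ω u v = 0 := by
  intro u hu v hv
  induction hu, hv using Submodule.span_induction₂ with
  | mem_mem u v hu hv => exact hs u hu v hv
  | zero_left => simp
  | zero_right => simp
  | add_left _ _ _ _ _ _ h1 h2 => simp [h1, h2]
  | add_right _ _ _ _ _ _ h1 h2 => simp [h1, h2]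
  | smul_left _ _ _ _ _ h => simp [h]
  | smul_right _ _ _ _ _ h => simp [h]

/-- Compression is linear, and the detectable errors are the preimage of the line of scalar
matrices. -/
theorem EACode.Detects.sum {q n k c : ℕ} (Q : EACode q n k c) {ι : Type*} (s : Finset ι)
    (f : ι → ℂ) (E : ι → Matrix (Fin n → Fin q) (Fin n → Fin q) ℂ)
    (h : ∀ i ∈ s, f i ≠ 0 → Q.Detects (E i)) : Q.Detects (∑ i ∈ s, f i • E i) := by
  let L : Matrix (Fin n → Fin q) (Fin n → Fin q) ℂ →ₗ[ℂ]
      Matrix (Fin k → Fin q) (Fin k → Fin q) ℂ :=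
    { toFun := fun E => Q.encode.conjTranspose *
        Matrix.kronecker E (1 : Matrix (Fin c → Fin q) (Fin c → Fin q) ℂ) * Q.encode
      map_add' := fun E E' => by
        rw [Matrix.kronecker, Matrix.add_kronecker, Matrix.mul_add, Matrix.add_mul]
      map_smul' := fun t E => by
        rw [Matrix.kronecker, Matrix.smul_kronecker, Matrix.mul_smul, Matrix.smul_mul]; rfl }
  have hL : ∀ E, Q.Detects E ↔ L E ∈ Submodule.span ℂ {(1 : Matrix (Fin k → Fin q) _ ℂ)} := by
    intro E
    rw [Submodule.mem_span_singleton]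
    exact exists_congr fun z => eq_comm
  rw [hL, map_sum]
  refine Submodule.sum_mem _ fun i hi => ?_
  rw [map_smul]
  by_cases hf : f i = 0
  · simp [hf]
  · exact Submodule.smul_mem _ _ ((hL _).1 (h i hi hf))

/-- An entanglement-assisted code from a pair of subspaces that are orthogonal complements of each
other. -/
theorem exists_eaCode_of_symplectic {p q n k c d : ℕ} [Fact p.Prime] (hp : p ≠ 2) {F : Type*}
    [AddCommGroup F] [Module (ZMod p) F] [Fintype F] [DecidableEq F]
    (hF : Fintype.card F = q ^ 2) (hq : q ≠ 0)
    {τ : F →ₗ[ZMod p] F →ₗ[ZMod p] ZMod p} (hτ : τ.IsAlt) (hnd : ∀ u, (∀ v, τ u v = 0) → u = 0)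
    (C D : Submodule (ZMod p) (Fin n → F))
    (hC : ∀ w, w ∈ C ↔ ∀ v ∈ D, piForm n τ v w = 0)
    (hD : ∀ v, v ∈ D ↔ ∀ w ∈ C, piForm n τ v w = 0)
    {e : ℕ} (hqe : q = p ^ e)
    (hCk : Module.finrank (ZMod p) C =
      Module.finrank (ZMod p) (C ⊓ D : Submodule (ZMod p) (Fin n → F)) + 2 * (e * k))
    (hDc : Module.finrank (ZMod p) D =
      Module.finrank (ZMod p) (C ⊓ D : Submodule (ZMod p) (Fin n → F)) + 2 * (e * c))
    (hmin : ∀ w ∈ C, w ≠ 0 → d ≤ hammingNorm w)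
    (hex : ∃ w ∈ C, w ∉ D ∧ hammingNorm w = d) :
    ∃ Q : EACode q n k c, Q.HasMinDist d := by
  have hW := exists_local_weylSystem (q := q) hp hF hτ hnd n
  have hω : (piForm n τ).IsAlt := piForm_isAlt hτ
  set ω := piForm n τ with hωdef
  obtain ⟨W, hWS, hWcomm⟩ := hW
  have hDC : ∀ v ∈ D, ∀ w ∈ C, ω v w = 0 := fun v hv => (hD v).1 hv
  have hCD : ∀ w ∈ C, ∀ v ∈ D, ω w v = 0 := fun w hw v hv => by
    rw [← hω.neg, hDC v hv w hw, neg_zero]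
  obtain ⟨mC, xC, zC, hxC, hzC, hhC, hdecC, hdimC⟩ := exists_isHyperbolic_submodule hω C D
    fun u hu => hD u
  obtain ⟨mD, xD, zD, hxD, hzD, hhD, hdecD, hdimD⟩ := exists_isHyperbolic_submodule hω D C
    fun u hu => by
      rw [hC u]
      exact forall₂_congr fun v _ => by rw [← hω.neg, neg_eq_zero]
  rw [inf_comm] at hdimD
  have hmC : mC = e * k := by omega
  have hmD : mD = e * c := by omega
  have hcard : ∀ m j : ℕ, m = e * j →
      Fintype.card (Fin j → Fin q) = Fintype.card (Fin m → ZMod p) := by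
    rintro m j rfl
    simp [hqe, pow_mul]
  let ek := Fintype.equivOfCardEq (hcard mC k hmC)
  let ec := Fintype.equivOfCardEq (hcard mD c hmD)
  let XA := Fintype.linearCombination (ZMod p) xC
  let XB := Fintype.linearCombination (ZMod p) xD
  have hXA : ∀ a, XA a = ∑ i, a i • xC i := fun a => Fintype.linearCombination_apply _ _ _
  have hXB : ∀ b, XB b = ∑ i, b i • xD i := fun a => Fintype.linearCombination_apply _ _ _
  have hXAC : ∀ a, XA a ∈ C := fun a => by
    rw [hXA]
    exact Submodule.sum_mem _ fun i _ => C.smul_mem _ (hxC i)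
  have hXBD : ∀ b, XB b ∈ D := fun b => by
    rw [hXB]
    exact Submodule.sum_mem _ fun i _ => D.smul_mem _ (hxD i)
  -- The stabilizer joins the common radical to one half of each hyperbolic family; C and D are
  -- mutually orthogonal, so it is isotropic.
  let Z : Submodule (ZMod p) (Fin n → F) :=
    Submodule.span (ZMod p) (((C ⊓ D : Submodule (ZMod p) (Fin n → F)) : Set (Fin n → F)) ∪
      Set.range zC ∪ Set.range zD)
  have hZrad : ∀ v ∈ C ⊓ D, v ∈ Z := fun v hv => Submodule.subset_span (Or.inl (Or.inl hv))
  have hZC : ∀ i, zC i ∈ Z := fun i => Submodule.subset_span (Or.inl (Or.inr ⟨i, rfl⟩))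
  have hZD : ∀ i, zD i ∈ Z := fun i => Submodule.subset_span (Or.inr ⟨i, rfl⟩)
  have hZ : ∀ z ∈ Z, ∀ z' ∈ Z, ω z z' = 0 := by
    apply isotropic_span
    rintro u ((hu | ⟨i, rfl⟩) | ⟨i, rfl⟩) v ((hv | ⟨j, rfl⟩) | ⟨j, rfl⟩)
    · exact hCD u hu.1 v hv.2
    · exact hDC u hu.2 _ (hzC j)
    · exact hCD u hu.1 _ (hzD j)
    · exact hCD _ (hzC i) v hv.2
    · exact hhC.zz i j
    · exact hCD _ (hzC i) _ (hzD j)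
    · exact hDC _ (hzD i) v hv.1
    · exact hDC _ (hzD i) _ (hzC j)
    · exact hhD.zz i j
  have hzXA : ∀ i a, ω (zC i) (XA a) = -a i := by
    intro i a
    simp [hXA, hhC.zx hω]
  have hzXB : ∀ i b, ω (zD i) (XB b) = -b i := by
    intro i b
    simp [hXB, hhD.zx hω]
  obtain ⟨Q, hdet, hundet⟩ := W.exists_eaCode hq hp hω Z hZ XA XB
    (fun a a' => by simp [hXA, hhC.xx]) (fun a b => hCD _ (hXAC a) _ (hXBD b))
    (fun b b' => by simp [hXB, hhD.xx])
    (by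
      rintro a b (h | h)
      · obtain ⟨i, hi⟩ := Function.ne_iff.1 h
        refine ⟨zC i, hZC i, ?_⟩
        rw [map_add, hzXA, hCD _ (hzC i) _ (hXBD b), add_zero]
        exact neg_ne_zero.2 hi
      · obtain ⟨i, hi⟩ := Function.ne_iff.1 h
        refine ⟨zD i, hZD i, ?_⟩
        rw [map_add, hzXB, hDC _ (hzD i) _ (hXAC a), zero_add]
        exact neg_ne_zero.2 hi)
    ek ec
  have hdetC : ∀ w, w ∉ C → Q.Detects (W.op w) := by
    intro w hw
    apply hdet
    by_contra! hcon
    obtain ⟨h1, h2⟩ := hcon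
    refine hw ((hC w).2 fun v hv => ?_)
    -- Split v in D into its radical part and its x and z parts. The radical and the z's lie in Z
    -- and commute with `XA`, while the x's are shifts `XB`; an error orthogonal to all of these is
    -- orthogonal to D, so it lies in C.
    have hr := hdecD v hv
    rw [← sub_add_cancel v (hyperbolicSum xD zD (fun i => ω v (zD i)) (fun i => ω v (xD i))),
      map_add, LinearMap.add_apply, h1 _ (hZrad _ hr.symm) (fun a => hDC _ hr.1 _ (hXAC a)),
      zero_add]
    have hx : ∀ i, ω (xD i) w = 0 := fun i => by
      rw [← hω.neg, neg_eq_zero]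
      simpa [hXB, Pi.single_apply, ite_smul] using h2 (Pi.single i 1)
    have hz : ∀ i, ω (zD i) w = 0 := fun i => h1 _ (hZD i) fun a => hDC _ (hzD i) _ (hXAC a)
    simp [hyperbolicSum, hx, hz]
  have hundetC : ∀ w ∈ C, w ∉ D → ¬ Q.Detects (W.op w) := by
    intro w hwC hwD
    refine hundet w (fun b => hCD w hwC _ (hXBD b)) ?_
    have hr := hdecC w hwC
    have hsum : ∀ a b, hyperbolicSum xC zC a b = XA a - ∑ i, b i • zC i := fun a b => by
      rw [hXA, hyperbolicSum, Finset.sum_sub_distrib]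
    have hzsum : ∀ b : Fin mC → ZMod p, ∑ i, b i • zC i ∈ Z := fun b =>
      Submodule.sum_mem _ fun i _ => Z.smul_mem _ (hZC i)
    have hmem : w - XA (fun i => ω w (zC i)) ∈ Z := by
      have := Z.sub_mem (hZrad _ hr) (hzsum fun i => ω w (xC i))
      rw [hsum] at this
      convert this using 1
      abel
    -- Modulo Z, w is the message shift with coordinates ω w (zC i). If these vanish, w lies in Z
    -- and must pair nontrivially with some xC i, since otherwise it would lie in D.
    by_cases ha : (fun i => ω w (zC i)) = 0
    · right
      rw [ha, map_zero, sub_zero] at hmem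
      refine ⟨hmem, ?_⟩
      by_contra! hb
      refine hwD ?_
      have hx : ∀ i, ω w (xC i) = 0 := fun i => by
        simpa [hXA, Pi.single_apply, ite_smul] using hb (Pi.single i 1)
      have h2 := hr.2
      rw [ha] at h2
      simpa [hyperbolicSum, hx] using h2
    · exact Or.inl ⟨_, ha, hmem⟩
  have : NeZero q := ⟨hq⟩
  refine ⟨Q, fun S hS E hE => ?_, ?_⟩
  · have hcardG : Fintype.card (Fin n → F) = Fintype.card (Fin n → Fin q) ^ 2 := by
      simp [hF, ← pow_mul, mul_comm]
    obtain ⟨f, rfl⟩ := W.exists_sum hω hcardG E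
    refine EACode.Detects.sum Q _ _ _ fun w _ hfw => ?_
    have hsupp : ∀ i, i ∉ S → w i = 0 := by
      intro i hi
      by_contra hwi
      obtain ⟨v, hv⟩ : ∃ v, τ (w i) v ≠ 0 := by
        by_contra! h
        exact hwi (hnd _ h)
      -- Test at a single site i outside S: E commutes with the Weyl operators there, whereas w i ≠
      -- 0 makes one of them fail to commute with that of w.
      refine hfw (W.coeff_eq_zero_of_commute hp hω f (u := Pi.single i v) ?_ (hWcomm S _ hE _ ?_))
      · rw [← hω.neg, hωdef, piForm_apply, Finset.sum_eq_single i]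
        · simpa using hv
        · intro j _ hj
          simp [hj]
        · simp
      · intro j hj
        rw [Pi.single_apply, if_neg]
        rintro rfl
        exact hi hj
    by_cases hw0 : w = 0
    · subst hw0
      refine ⟨1, ?_⟩
      ext x x'
      rw [W.op_zero, Q.compress_apply, Matrix.mul_one, Q.isometry]
      simp only [Matrix.one_apply, Prod.mk.injEq, and_true, Finset.sum_const, Finset.card_univ,
        Fintype.card_fun, Fintype.card_fin, one_smul, nsmul_eq_mul, Nat.cast_pow]
      rw [← mul_assoc, inv_mul_cancel₀ (pow_ne_zero _ (Nat.cast_ne_zero.2 hq)), one_mul]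
    · refine hdetC w fun hwC => ?_
      have h1 := hmin w hwC hw0
      have h2 : hammingNorm w ≤ S.card := by
        refine Finset.card_le_card fun i hi => ?_
        by_contra hiS
        exact (Finset.mem_filter.1 hi).2 (hsupp i hiS)
      omega
  · obtain ⟨w, hwC, hwD, hwd⟩ := hex
    refine ⟨Finset.univ.filter fun i => w i ≠ 0, hwd, W.op w, hWS _ w fun i hi => ?_,
      hundetC w hwC hwD⟩
    simpa using hi

/-! ### The alternating trace form attached to the Hermitian form -/

section HermitianForm

variable {p : ℕ} [Fact p.Prime] {F : Type*} [Field F] [Algebra (ZMod p) F] [CharP F p]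

/-- The form `Tr (γ u v ^ (p ^ e))`. -/
noncomputable def hermTraceForm (e : ℕ) (γ : F) : F →ₗ[ZMod p] F →ₗ[ZMod p] ZMod p :=
  (LinearMap.mul (ZMod p) F).compr₂ (Algebra.trace (ZMod p) F) |>.compl₁₂
    (LinearMap.mulLeft (ZMod p) γ)
    ((iterateFrobenius F p e).toAddMonoidHom.toZModLinearMap p)

theorem hermTraceForm_apply (e : ℕ) (γ u v : F) : hermTraceForm e γ u v =
    Algebra.trace (ZMod p) F (γ * u * v ^ p ^ e) := rfl

theorem trace_pow_char_pow [Fintype F] (e : ℕ) (x : F) :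
    Algebra.trace (ZMod p) F (x ^ p ^ e) = Algebra.trace (ZMod p) F x := by
  induction e with
  | zero => simp
  | succ e ih =>
    rw [pow_succ, pow_mul, ← ih]
    have := Algebra.trace_eq_of_algEquiv (FiniteField.frobeniusAlgEquiv (ZMod p) F p) (x ^ p ^ e)
    simpa using this

/-- The p^e-th power map negates γ u^(p^e+1) and preserves the trace, so the trace equals its own
negative, and p is odd. -/
theorem hermTraceForm_isAlt [Fintype F] (hp : p ≠ 2) {e : ℕ} {γ : F} (hγ : γ ^ p ^ e = -γ)
    (hF : Fintype.card F = (p ^ e) ^ 2) : (hermTraceForm (p := p) e γ).IsAlt := by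
  intro u
  have h1 := trace_pow_char_pow (p := p) e (γ * u * u ^ p ^ e)
  have h2 : (γ * u * u ^ p ^ e) ^ p ^ e = -(γ * u * u ^ p ^ e) := by
    rw [mul_pow, mul_pow, hγ, ← pow_mul, ← sq, ← hF, FiniteField.pow_card]
    ring
  rw [h2, map_neg] at h1
  rw [hermTraceForm_apply]
  have h3 : (2 : ZMod p) * Algebra.trace (ZMod p) F (γ * u * u ^ p ^ e) = 0 := by
    linear_combination -h1
  exact (mul_eq_zero.1 h3).resolve_left (ZMod.two_ne_zero_of_ne hp)

end HermitianForm

theorem eq_zero_of_trace_mul {p : ℕ} [Fact p.Prime] {F : Type*} [Field F] [Algebra (ZMod p) F]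
    [Fintype F] {a : F} (h : ∀ b : F, Algebra.trace (ZMod p) F (a * b) = 0) : a = 0 :=
  (traceForm_nondegenerate (ZMod p) F).1 a h


/-- An entanglement-assisted code from a pair of Hermitian dual linear codes. -/
theorem exists_eaCode_of_hermitian {p e q n k c d : ℕ} (hp : p.Prime) (hp2 : p ≠ 2)
    (hqe : q = p ^ e) {F : Type*} [Field F] [Fintype F] [DecidableEq F] [CharP F p]
    (hF : Fintype.card F = q ^ 2) {γ : F} (hγ0 : γ ≠ 0) (hγ : γ ^ q = -γ)
    (C D : Submodule F (Fin n → F))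
    (hC : ∀ w, w ∈ C ↔ ∀ v ∈ D, ∑ i, v i * w i ^ q = 0)
    (hD : ∀ v, v ∈ D ↔ ∀ w ∈ C, ∑ i, v i * w i ^ q = 0)
    (hCk : Module.finrank F C = Module.finrank F (C ⊓ D : Submodule F (Fin n → F)) + k)
    (hDc : Module.finrank F D = Module.finrank F (C ⊓ D : Submodule F (Fin n → F)) + c)
    (hmin : ∀ w ∈ C, w ≠ 0 → d ≤ hammingNorm w)
    (hex : ∃ w ∈ C, w ∉ D ∧ hammingNorm w = d) :
    ∃ Q : EACode q n k c, Q.HasMinDist d := by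
  have : Fact p.Prime := ⟨hp⟩
  let _ : Algebra (ZMod p) F := ZMod.algebra F p
  subst hqe
  set τ := hermTraceForm (p := p) e γ with hτdef
  have hpi : ∀ u v : Fin n → F, piForm n τ u v =
      Algebra.trace (ZMod p) F (γ * ∑ i, u i * v i ^ p ^ e) := by
    intro u v
    rw [piForm_apply, Finset.mul_sum, map_sum]
    refine Finset.sum_congr rfl fun i _ => ?_
    rw [hτdef, hermTraceForm_apply, mul_assoc]
  have hzero : ∀ (D : Submodule F (Fin n → F)) (w : Fin n → F),
      (∀ v ∈ D, ∑ i, v i * w i ^ p ^ e = 0) ↔ ∀ v ∈ D, piForm n τ v w = 0 := by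
    intro D w
    refine ⟨fun h v hv => by rw [hpi, h v hv, mul_zero, map_zero], fun h v hv => ?_⟩
    -- Linearity of D over F lets v be scaled by every b, so vanishing traces upgrade to the
    -- vanishing of the F-valued product.
    have h1 : γ * ∑ i, v i * w i ^ p ^ e = 0 := eq_zero_of_trace_mul (p := p) fun b => by
      rw [← h (b • v) (D.smul_mem b hv), hpi]
      congr 1
      simp only [Pi.smul_apply, smul_eq_mul, mul_assoc, ← Finset.mul_sum]
      ring
    exact (mul_eq_zero.1 h1).resolve_left hγ0
  have halt : τ.IsAlt := hermTraceForm_isAlt hp2 hγ hF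
  have hfin : Module.finrank (ZMod p) F = 2 * e := by
    have h := Module.card_eq_pow_finrank (K := ZMod p) (V := F)
    rw [hF, ZMod.card, ← pow_mul] at h
    rw [mul_comm]
    exact (Nat.pow_right_injective hp.two_le h).symm
  have hres : ∀ U : Submodule F (Fin n → F),
      Module.finrank (ZMod p) (U.restrictScalars (ZMod p)) = 2 * e * Module.finrank F U := by
    intro U
    rw [← hfin]
    exact (Module.finrank_mul_finrank (ZMod p) F U).symm
  have hinf : C.restrictScalars (ZMod p) ⊓ D.restrictScalars (ZMod p) =
      (C ⊓ D).restrictScalars (ZMod p) := rfl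
  have hsym : ∀ (C : Submodule F (Fin n → F)) (v : Fin n → F),
      (∀ w ∈ C, ∑ i, v i * w i ^ p ^ e = 0) ↔ ∀ w ∈ C, piForm n τ v w = 0 := by
    intro C v
    have hconj : ∀ w : Fin n → F, ∑ i, v i * w i ^ p ^ e = (∑ i, w i * v i ^ p ^ e) ^ p ^ e := by
      intro w
      rw [sum_pow_char_pow]
      refine Finset.sum_congr rfl fun i _ => ?_
      rw [mul_pow, ← pow_mul, ← sq, ← hF, FiniteField.pow_card, mul_comm]
    have hpos : p ^ e ≠ 0 := pow_ne_zero _ hp.ne_zero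
    have : (∀ w ∈ C, ∑ i, v i * w i ^ p ^ e = 0) ↔ ∀ w ∈ C, ∑ i, w i * v i ^ p ^ e = 0 :=
      forall₂_congr fun w _ => by rw [hconj w, pow_eq_zero_iff hpos]
    rw [this, hzero]
    exact forall₂_congr fun w _ => by rw [← (piForm_isAlt halt).neg, neg_eq_zero]
  refine exists_eaCode_of_symplectic hp2 hF (pow_ne_zero _ hp.ne_zero) halt ?_
    (C.restrictScalars (ZMod p)) (D.restrictScalars (ZMod p))
    (fun w => (hC w).trans (hzero D w)) (fun v => (hD v).trans (hsym C v)) rfl ?_ ?_ hmin hex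
  · intro u hu
    by_contra hu0
    have h1 : ∀ b, Algebra.trace (ZMod p) F (γ * u * b) = 0 := by
      intro b
      rw [← hu (b ^ p ^ e), hτdef, hermTraceForm_apply, ← pow_mul, ← sq, ← hF,
        FiniteField.pow_card]
    exact mul_ne_zero hγ0 hu0 (eq_zero_of_trace_mul h1)
  · rw [hinf, hres, hres, hCk]
    ring
  · rw [hinf, hres, hres, hDc]
    ring

/-! ### Matrices -/


/-- The rank normal form is an equation with invertible factors, and a field homomorphism preserves
it. -/
theorem Matrix.rank_map_ringHom {m F K : Type*} [Fintype m] [DecidableEq m] [Field F] [Field K]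
    (f : F →+* K) (M : Matrix m m F) : (M.map f).rank = M.rank := by
  classical
  obtain ⟨V, U, e, hV, hU, h⟩ := M.exists_rank_normal_form
  have hV' : IsUnit (V.map f).det := by
    have := ((Matrix.isUnit_iff_isUnit_det _).1 hV).map f
    rwa [RingHom.map_det] at this
  have hU' : IsUnit (U.map f).det := by
    have := ((Matrix.isUnit_iff_isUnit_det _).1 hU).map f
    rwa [RingHom.map_det] at this
  rw [← rank_mul_eq_right_of_isUnit_det (V.map f) _ hV',
    ← rank_mul_eq_left_of_isUnit_det (U.map f) _ hU', ← Matrix.map_mul, ← Matrix.map_mul, h,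
    ← Matrix.submatrix_map, Matrix.rank_submatrix, Matrix.fromBlocks_map]
  have hd : Matrix.fromBlocks ((1 : Matrix (Fin M.rank) (Fin M.rank) F).map f)
      ((0 : Matrix (Fin M.rank) (Fin (Fintype.card m - M.rank)) F).map f)
      ((0 : Matrix (Fin (Fintype.card m - M.rank)) (Fin M.rank) F).map f)
      ((0 : Matrix _ (Fin (Fintype.card m - M.rank)) F).map f) =
      Matrix.diagonal (Sum.elim (fun _ => (1 : K)) (fun _ => 0)) := by
    ext (i | i) (j | j) <;> simp [Matrix.diagonal_apply, Matrix.one_apply]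
  rw [hd, Matrix.rank_diagonal]
  rw [Fintype.card_subtype, Finset.card_filter, Fintype.sum_sum_type]
  simp

open scoped Matrix in
-- A functional that vanishes on the common kernel of the rows of V is a combination of those rows;
-- apply this to each row of H.
theorem Matrix.exists_eq_mul_of_ker_le {a b ι K : Type*} [Fintype b] [Fintype ι] [Field K]
    (H : Matrix a ι K) (V : Matrix b ι K) (h : ∀ x, V.mulVec x = 0 → H.mulVec x = 0) :
    ∃ A : Matrix a b K, H = A * V := by
  classical
  have key : ∀ i, ∃ c : b → K, H.row i = c ᵥ* V := by
    intro i
    have hs := mem_span_of_iInf_ker_le_ker (L := fun j => dotProductEquiv K ι (V.row j))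
      (K := dotProductEquiv K ι (H.row i)) (fun x hx => by
        rw [Submodule.mem_iInf] at hx
        exact congrFun (h x (funext hx)) i)
    obtain ⟨c, hc⟩ := (Submodule.mem_span_range_iff_exists_fun K).1 hs
    refine ⟨c, (dotProductEquiv K ι).injective ?_⟩
    rw [← hc, Matrix.vecMul_eq_sum, map_sum]
    simp only [map_smul]
    rfl
  choose A hA using key
  exact ⟨Matrix.of A, Matrix.ext fun i j => congrFun (hA i) j⟩

/-! ### Words and polynomials -/

section Words

open Polynomial

variable {F : Type*} [Field F] {n : ℕ}

theorem coeff_wordPoly (c : Fin n → F) (i : ℕ) :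
    (wordPoly c).coeff i = if h : i < n then c ⟨i, h⟩ else 0 := by
  rw [wordPoly, finsetSum_coeff]
  simp only [coeff_C_mul, coeff_X_pow, mul_ite, mul_one, mul_zero]
  split_ifs with h
  · rw [Finset.sum_eq_single ⟨i, h⟩]
    · simp
    · intro j _ hj
      rw [if_neg]
      rintro rfl
      exact hj rfl
    · simp
  · refine Finset.sum_eq_zero fun j _ => if_neg ?_
    rintro rfl
    exact h j.2

theorem degree_wordPoly_lt (c : Fin n → F) : (wordPoly c).degree < n := by
  rw [degree_lt_iff_coeff_zero]
  intro i hi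
  rw [coeff_wordPoly, dif_neg (by omega)]

theorem wordPoly_coeff {f : F[X]} (hf : f.degree < n) :
    wordPoly (fun i : Fin n => f.coeff i) = f := by
  ext i
  rw [coeff_wordPoly]
  split_ifs with h
  · rfl
  · rw [coeff_eq_zero_of_degree_lt (hf.trans_le (by exact_mod_cast not_lt.1 h))]

theorem coeff_wordPoly_fin (c : Fin n → F) : (fun i : Fin n => (wordPoly c).coeff i) = c := by
  funext i
  rw [coeff_wordPoly, dif_pos i.2]

theorem wordPoly_ne_zero {c : Fin n → F} (hc : c ≠ 0) : wordPoly c ≠ 0 := by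
  intro h
  apply hc
  rw [← coeff_wordPoly_fin c, h]
  rfl

theorem aeval_wordPoly {K : Type*} [Field K] [Algebra F K] (c : Fin n → F) (x : K) :
    aeval x (wordPoly c) = ∑ i, algebraMap F K (c i) * x ^ i.val := by
  simp [wordPoly]

/-- The word of the polynomial `X ^ j * g`. -/
noncomputable def shiftWord (n : ℕ) (g : F[X]) (j : ℕ) : Fin n → F :=
  fun i => (X ^ j * g).coeff i

theorem hammingNorm_shiftWord_le [DecidableEq F] (g : F[X]) (j : ℕ) :
    hammingNorm (shiftWord n g j) ≤ g.natDegree + 1 := by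
  classical
  have : (Finset.univ.filter fun i => shiftWord n g j i ≠ 0).map Fin.valEmbedding ⊆
      Finset.Icc j (j + g.natDegree) := by
    intro i hi
    obtain ⟨i, hi', rfl⟩ := Finset.mem_map.1 hi
    replace hi := (Finset.mem_filter.1 hi').2
    rw [Fin.valEmbedding_apply]
    rw [shiftWord, coeff_X_pow_mul', ne_eq, ite_eq_right_iff, Classical.not_imp] at hi
    have := le_natDegree_of_ne_zero hi.2
    rw [Finset.mem_Icc]
    omega
  have h := Finset.card_le_card this
  rw [Finset.card_map, Nat.card_Icc] at h
  change Finset.card _ ≤ _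
  omega

variable {α : F} {C : Submodule F (Fin n → F)} {g : F[X]}

theorem wordPoly_shiftWord {j : ℕ} (hj : j + g.natDegree < n) :
    wordPoly (shiftWord n g j) = X ^ j * g := by
  refine wordPoly_coeff ?_
  by_cases hg : g = 0
  · simp [hg]
  rw [degree_mul, degree_X_pow, degree_eq_natDegree hg]
  exact_mod_cast hj

theorem IsGeneratorPoly.shiftWord_mem (hg : IsGeneratorPoly α C g) {j : ℕ}
    (hj : j + g.natDegree < n) : shiftWord n g j ∈ C := by
  rw [hg.mem_iff, wordPoly_shiftWord hj]
  exact dvd_mul_left _ _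

theorem shiftWord_ne_zero {j : ℕ} (hg : g.Monic) (hj : j + g.natDegree < n) :
    shiftWord n g j ≠ 0 := by
  intro h
  have h1 := wordPoly_shiftWord hj
  rw [h] at h1
  have h0 : wordPoly (0 : Fin n → F) = 0 := by simp [wordPoly]
  rw [h0] at h1
  exact mul_ne_zero (pow_ne_zero _ X_ne_zero) hg.ne_zero h1.symm

/-- Multiples of `g` of degree less than `n` are combinations of the shifts of `g`. -/
theorem word_eq_sum_shiftWord {K : Type*} [Field K] [Algebra F K] (hg : g.Monic)
    (hgn : g.natDegree ≤ n) {c : Fin n → K} (hc : g.map (algebraMap F K) ∣ wordPoly c) :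
    ∃ b : Fin (n - g.natDegree) → K,
      c = ∑ j, b j • fun i => algebraMap F K (shiftWord n g j i) := by
  obtain ⟨f, hf⟩ := hc
  refine ⟨fun j => f.coeff j, ?_⟩
  have hfd : f.degree < (n - g.natDegree : ℕ) := by
    by_cases hf0 : f = 0
    · simp [hf0]
    have h1 := degree_wordPoly_lt c
    rw [hf, degree_mul, degree_map, degree_eq_natDegree hg.ne_zero, degree_eq_natDegree hf0] at h1
    rw [degree_eq_natDegree hf0]
    have h2 : g.natDegree + f.natDegree < n := by exact_mod_cast h1
    exact_mod_cast (by omega : f.natDegree < n - g.natDegree)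
  have hsum : f = ∑ j : Fin (n - g.natDegree), C (f.coeff j) * X ^ j.val := (wordPoly_coeff hfd).symm
  funext i
  have h3 := congrFun (coeff_wordPoly_fin c) i
  rw [← h3, hf]
  conv_lhs => rw [hsum]
  rw [Finset.mul_sum, finsetSum_coeff, Finset.sum_apply]
  refine Finset.sum_congr rfl fun j _ => ?_
  rw [Pi.smul_apply, smul_eq_mul, shiftWord, mul_left_comm, coeff_C_mul, mul_comm (g.map _),
    ← coeff_map, Polynomial.map_mul, Polynomial.map_pow, map_X]

theorem IsGeneratorPoly.eq_span (hg : IsGeneratorPoly α C g) (hgn : g.natDegree ≤ n) :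
    C = Submodule.span F (Set.range fun j : Fin (n - g.natDegree) => shiftWord n g j) := by
  apply le_antisymm
  · intro c hc
    obtain ⟨b, hb⟩ := word_eq_sum_shiftWord (K := F) hg.monic hgn (c := c)
      (by simpa using (hg.mem_iff c).1 hc)
    rw [hb]
    exact Submodule.sum_mem _ fun j _ => Submodule.smul_mem _ _ (Submodule.subset_span ⟨j, rfl⟩)
  · rw [Submodule.span_le]
    rintro _ ⟨j, rfl⟩
    exact hg.shiftWord_mem (by omega)

theorem IsGeneratorPoly.finrank_eq (hg : IsGeneratorPoly α C g) (hgn : g.natDegree ≤ n) :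
    Module.finrank F C = n - g.natDegree := by
  have hli : LinearIndependent F fun j : Fin (n - g.natDegree) => shiftWord n g j := by
    rw [Fintype.linearIndependent_iff]
    intro b hb
    -- A relation among the shifts says that the product of a polynomial of degree below n - deg g
    -- with g is zero.
    have h1 : wordPoly b * g = 0 := by
      ext i
      rw [coeff_zero]
      by_cases hi : i < n
      · have := congrFun hb ⟨i, hi⟩
        simpa [wordPoly, Finset.sum_mul, shiftWord, mul_assoc] using this
      · apply coeff_eq_zero_of_degree_lt
        by_cases hb0 : wordPoly b = 0
        · simp [hb0]
        have h2 := degree_wordPoly_lt b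
        rw [degree_eq_natDegree hb0] at h2
        rw [degree_mul, degree_eq_natDegree hb0, degree_eq_natDegree hg.monic.ne_zero]
        have h3 : (wordPoly b).natDegree < n - g.natDegree := by exact_mod_cast h2
        exact_mod_cast (by omega : (wordPoly b).natDegree + g.natDegree < i)
    have h2 := (mul_eq_zero.1 h1).resolve_right hg.monic.ne_zero
    intro j
    by_contra hj
    exact wordPoly_ne_zero (c := b) (fun h => hj (congrFun h j)) h2
  have := finrank_span_eq_card hli
  rw [← hg.eq_span hgn, Fintype.card_fin] at this
  exact this

end Words

/-! ### Constacyclic codes whose zeros form an interval -/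

section RootInterval

open Polynomial

variable {F K : Type*} [Field F] [Field K] [Algebra F K] {n m : ℕ} {α : F}
  {C : Submodule F (Fin n → F)} {g : F[X]} {β ζ : K}

/-- The zeros of `g` are `β ζ ^ j` for `- m ≤ j ≤ m`. -/
structure IsRootInterval (n m : ℕ) (α : F) (g : F[X]) (β ζ : K) : Prop where
  primitive : IsPrimitiveRoot ζ n
  pow_eq : β ^ n = algebraMap F K α
  ne_zero : β ≠ 0
  lt : 2 * m + 1 ≤ n
  aeval_eq_zero_iff : ∀ x : K, aeval x g = 0 ↔ ∃ j ∈ Finset.Icc (-(m : ℤ)) m, x = β * ζ ^ j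

theorem IsRootInterval.injOn (h : IsRootInterval n m α g β ζ) :
    Set.InjOn (fun j : ℤ => β * ζ ^ j) (Finset.Icc (-(m : ℤ)) m) := by
  intro i hi j hj hij
  have hζ0 : ζ ≠ 0 := h.primitive.ne_zero (by have := h.lt; omega)
  have h1 : ζ ^ i = ζ ^ j := mul_left_cancel₀ h.ne_zero hij
  have h2 : ζ ^ (i - j) = 1 := by rw [zpow_sub₀ hζ0, h1, div_self (zpow_ne_zero _ hζ0)]
  rw [h.primitive.zpow_eq_one_iff_dvd] at h2
  have hlt := h.lt
  simp only [Finset.coe_Icc, Set.mem_Icc] at hi hj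
  have := Int.eq_zero_of_abs_lt_dvd h2 (by rw [abs_lt]; omega)
  omega

theorem card_Icc_neg (m : ℕ) : (Finset.Icc (-(m : ℤ)) m).card = 2 * m + 1 := by
  rw [Int.card_Icc]
  omega

/-- X^n - α splits over K without repeated roots, so its monic divisor g is determined by its set of
zeros. -/
theorem IsRootInterval.map_eq (h : IsRootInterval n m α g β ζ) (hg : IsGeneratorPoly α C g) :
    g.map (algebraMap F K) =
      (((Finset.Icc (-(m : ℤ)) m).val.map fun j => β * ζ ^ j).map fun a => X - Polynomial.C a).prod := by
  have hdvd : g.map (algebraMap F K) ∣ X ^ n - Polynomial.C (algebraMap F K α) := by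
    simpa using Polynomial.map_dvd (algebraMap F K) hg.dvd
  have hn : n ≠ 0 := by have := h.lt; omega
  have hne : (X ^ n - Polynomial.C (algebraMap F K α) : K[X]) ≠ 0 := X_pow_sub_C_ne_zero (by omega) _
  have hsplit := X_pow_sub_C_splits_of_isPrimitiveRoot h.primitive h.pow_eq
  have hα : algebraMap F K α ≠ 0 := by rw [← h.pow_eq]; exact pow_ne_zero _ h.ne_zero
  have : NeZero n := ⟨hn⟩
  have hsep : (X ^ n - Polynomial.C (algebraMap F K α) : K[X]).Separable :=
    separable_X_pow_sub_C _ (h.primitive.neZero').out hα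
  have hmon := hg.monic.map (algebraMap F K)
  rw [(hsplit.of_dvd hne hdvd).eq_prod_roots_of_monic hmon]
  congr 2
  refine (Multiset.Nodup.ext (nodup_roots (hsep.of_dvd hdvd)) ?_).2 fun x => ?_
  · exact Multiset.Nodup.map_on (fun i hi j hj => h.injOn hi hj) (Finset.nodup _)
  · rw [mem_roots hmon.ne_zero, IsRoot.def, eval_map_algebraMap, h.aeval_eq_zero_iff,
      Multiset.mem_map]
    exact exists_congr fun j => and_congr Iff.rfl eq_comm

theorem IsRootInterval.natDegree_eq (h : IsRootInterval n m α g β ζ)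
    (hg : IsGeneratorPoly α C g) : g.natDegree = 2 * m + 1 := by
  rw [← natDegree_map (algebraMap F K), h.map_eq hg, natDegree_multiset_prod_X_sub_C_eq_card,
    Multiset.card_map, ← card_Icc_neg]
  rfl

theorem IsRootInterval.map_dvd (h : IsRootInterval n m α g β ζ) (hg : IsGeneratorPoly α C g)
    {f : K[X]} (hf : ∀ j ∈ Finset.Icc (-(m : ℤ)) m, f.eval (β * ζ ^ j) = 0) :
    g.map (algebraMap F K) ∣ f := by
  by_cases hf0 : f = 0
  · rw [hf0]
    exact dvd_zero _
  rw [h.map_eq hg, Multiset.prod_X_sub_C_dvd_iff_le_roots hf0, Multiset.le_iff_subset]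
  · intro x hx
    obtain ⟨j, hj, rfl⟩ := Multiset.mem_map.1 hx
    rw [mem_roots hf0]
    exact hf j hj
  · exact Multiset.Nodup.map_on (fun i hi j hj => h.injOn hi hj) (Finset.nodup _)

/-- The BCH bound. -/
theorem IsRootInterval.le_hammingNorm [DecidableEq F] (h : IsRootInterval n m α g β ζ)
    (hg : IsGeneratorPoly α C g) {c : Fin n → F} (hc : c ∈ C) (hc0 : c ≠ 0) :
    2 * m + 2 ≤ hammingNorm c := by
  by_contra! hlt
  have hζ0 : ζ ≠ 0 := h.primitive.ne_zero (by have := h.lt; omega)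
  -- Absorbing the leftmost zero βζ^(-m) into the coefficients turns the 2m+1 conditions into power
  -- sums with exponents 0, …, 2m.
  let b : Fin n → K := fun i => algebraMap F K (c i) * (β * ζ ^ (-(m : ℤ))) ^ i.val
  have hpow : ∀ t ≤ 2 * m, ∑ i, b i * (ζ ^ i.val) ^ t = 0 := by
    intro t ht
    have h1 : aeval (β * ζ ^ ((t : ℤ) - m)) (wordPoly c) = 0 := by
      have h2 := (h.aeval_eq_zero_iff _).2 ⟨(t : ℤ) - m, by rw [Finset.mem_Icc]; omega, rfl⟩
      obtain ⟨f, hf⟩ := (hg.mem_iff c).1 hc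
      rw [hf, map_mul, h2, zero_mul]
    rw [aeval_wordPoly] at h1
    rw [← h1]
    refine Finset.sum_congr rfl fun i _ => ?_
    simp only [b]
    rw [mul_assoc, pow_right_comm, ← mul_pow, mul_assoc β, ← zpow_natCast ζ t, ← zpow_add₀ hζ0,
      neg_add_eq_sub]
  have hpoly : ∀ P : K[X], P.natDegree ≤ 2 * m → ∑ i, b i * P.eval (ζ ^ i.val) = 0 := by
    intro P hP
    simp only [eval_eq_sum_range, Finset.mul_sum]
    rw [Finset.sum_comm]
    refine Finset.sum_eq_zero fun t ht => ?_
    have := hpow t (by rw [Finset.mem_range] at ht; omega)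
    rw [← mul_zero (P.coeff t), ← this, Finset.mul_sum]
    exact Finset.sum_congr rfl fun i _ => by ring
  obtain ⟨i₀, hi₀⟩ := Function.ne_iff.1 hc0
  let S := (Finset.univ.filter fun i => c i ≠ 0).erase i₀
  have hSc : S.card ≤ 2 * m := by
    have h1 : S.card = hammingNorm c - 1 := Finset.card_erase_of_mem (by simpa using hi₀)
    omega
  -- P kills every support position but i₀ and has degree at most 2m, so a single nonzero term would
  -- have to vanish. This replaces the Vandermonde determinant.
  let P : K[X] := ∏ i ∈ S, (X - Polynomial.C (ζ ^ i.val))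
  have hP := hpoly P (by
    rw [natDegree_prod_of_monic _ _ fun i _ => monic_X_sub_C _]
    simpa only [natDegree_X_sub_C, Finset.sum_const, smul_eq_mul, mul_one] using hSc)
  rw [Finset.sum_eq_single i₀] at hP
  · rcases mul_eq_zero.1 hP with h1 | h1
    · have h2 : β * ζ ^ (-(m : ℤ)) ≠ 0 := mul_ne_zero h.ne_zero (zpow_ne_zero _ hζ0)
      rcases mul_eq_zero.1 h1 with h3 | h3
      · exact hi₀ (by simpa using h3)
      · exact pow_ne_zero _ h2 h3
    · rw [eval_prod, Finset.prod_eq_zero_iff] at h1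
      obtain ⟨i, hi, h2⟩ := h1
      rw [eval_sub, eval_X, eval_C, sub_eq_zero] at h2
      exact (Finset.mem_erase.1 hi).1 (Fin.ext (h.primitive.pow_inj i₀.2 i.2 h2)).symm
  · intro i _ hi
    by_cases hci : c i = 0
    · simp [b, hci]
    · have hiS : i ∈ S := Finset.mem_erase.2 ⟨hi, by simpa using hci⟩
      rw [eval_prod, Finset.prod_eq_zero hiS (by simp), mul_zero]
  · simp

/-- The number of coefficients of g, at most deg g + 1, meets the BCH bound. -/
theorem IsRootInterval.hammingNorm_shiftWord [DecidableEq F] (h : IsRootInterval n m α g β ζ)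
    (hg : IsGeneratorPoly α C g) {j : ℕ} (hj : j + g.natDegree < n) :
    hammingNorm (shiftWord n g j) = 2 * m + 2 := by
  refine le_antisymm ?_ (h.le_hammingNorm hg (hg.shiftWord_mem hj) (shiftWord_ne_zero hg.monic hj))
  have := hammingNorm_shiftWord_le (n := n) g j
  rw [h.natDegree_eq hg] at this
  exact this

theorem IsRootInterval.hasMinWeight [DecidableEq F] (h : IsRootInterval n m α g β ζ)
    (hg : IsGeneratorPoly α C g) (hlt : 2 * m + 1 < n) : HasMinWeight C (2 * m + 2) := by
  have hj : 0 + g.natDegree < n := by rw [h.natDegree_eq hg]; omega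
  refine ⟨⟨_, hg.shiftWord_mem hj, shiftWord_ne_zero hg.monic hj, h.hammingNorm_shiftWord hg hj⟩, ?_⟩
  rintro w ⟨c, hc, hc0, rfl⟩
  exact h.le_hammingNorm hg hc hc0

theorem IsParityCheck.finrank_add {k : ℕ} {H : Matrix (Fin k) (Fin n) F}
    (hH : IsParityCheck C H) : k + Module.finrank F C = n := by
  have h1 := hH.1.rank_matrix
  have h2 := H.mulVecLin.finrank_range_add_finrank_ker
  have h3 : LinearMap.ker H.mulVecLin = C := by
    ext x
    rw [LinearMap.mem_ker, hH.2, Matrix.mulVecLin_apply]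
  rw [h3] at h2
  rw [Matrix.rank] at h1
  simpa [h1] using h2

/-- The Hermitian products of the evaluation vectors at the zeros of `g`. -/
noncomputable def zeroGram (n m q : ℕ) (β ζ : K) :
    Matrix (Finset.Icc (-(m : ℤ)) m) (Finset.Icc (-(m : ℤ)) m) K :=
  fun i j => ∑ l : Fin n, (β * ζ ^ i.val) ^ l.val * ((β * ζ ^ j.val) ^ l.val) ^ q

/-- Over K one has H = A V with V the evaluation matrix at the zeros, because words killed by V are
combinations of shifts of g. Both matrices have 2m+1 rows and the rows of H are independent, so A is
invertible. Thus HH* is the Gram matrix between A and its conjugate transpose. -/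
theorem IsRootInterval.rank_hermitian {p e k : ℕ} [Fact p.Prime] [CharP K p]
    (h : IsRootInterval n m α g β ζ) (hg : IsGeneratorPoly α C g)
    {H : Matrix (Fin k) (Fin n) F} (hH : IsParityCheck C H) :
    (H * hermTranspose (p ^ e) H).rank = (zeroGram n m (p ^ e) β ζ).rank := by
  have hdeg := h.natDegree_eq hg
  have hlt := h.lt
  have hk : k = 2 * m + 1 := by
    have h1 := hH.finrank_add
    rw [hg.finrank_eq (by omega), hdeg] at h1
    omega
  let J := Finset.Icc (-(m : ℤ)) m
  have hcard : Fintype.card J = Fintype.card (Fin k) := by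
    rw [Fintype.card_coe, card_Icc_neg, Fintype.card_fin, hk]
  let f : J ≃ Fin k := Fintype.equivOfCardEq hcard
  let φ := iterateFrobenius K p e
  let HK : Matrix J (Fin n) K := (H.submatrix f id).map (algebraMap F K)
  let V : Matrix J (Fin n) K := fun j l => (β * ζ ^ j.val) ^ l.val
  obtain ⟨A, hA⟩ := HK.exists_eq_mul_of_ker_le V (by
    intro x hx
    obtain ⟨b, rfl⟩ := word_eq_sum_shiftWord hg.monic (by omega)
      (h.map_dvd hg (f := wordPoly x) fun j hj => by
        have := congrFun hx ⟨j, hj⟩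
        rw [← coe_aeval_eq_eval, aeval_wordPoly]
        rw [Matrix.mulVec, dotProduct] at this
        rw [Pi.zero_apply] at this
        rw [← this]
        exact Finset.sum_congr rfl fun l _ => by rw [mul_comm]; rfl)
    rw [Matrix.mulVec_sum]
    refine Finset.sum_eq_zero fun j _ => ?_
    rw [Matrix.mulVec_smul]
    have h1 := (hH.2 _).1 (hg.shiftWord_mem (j := j) (by omega))
    have h2 : HK.mulVec (fun i => algebraMap F K (shiftWord n g j i)) = 0 := by
      funext i
      have h3 := congrArg (algebraMap F K) (congrFun h1 (f i))
      rw [Matrix.mulVec, dotProduct, map_sum] at h3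
      simpa [HK, Matrix.mulVec, dotProduct] using h3
    rw [h2, smul_zero])
  have hHK : LinearIndependent K HK.row := by
    have h1 : LinearIndependent F (H.submatrix f id).row := hH.1.comp f f.injective
    exact linearIndependent_algebraMap_comp_iff.2 h1
  have hAu : IsUnit A := by
    rw [← Matrix.linearIndependent_rows_iff_isUnit, ← Matrix.vecMul_injective_iff]
    rw [← Matrix.vecMul_injective_iff] at hHK
    intro u v huv
    refine hHK ?_
    simp only [hA, ← Matrix.vecMul_vecMul]
    exact congrArg (fun w => Matrix.vecMul w V) huv
  have hAdet := (Matrix.isUnit_iff_isUnit_det _).1 hAu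
  have hφdet : IsUnit ((A.map φ).transpose).det := by
    rw [Matrix.det_transpose]
    have := hAdet.map φ
    rwa [RingHom.map_det] at this
  have hgram : V * (V.map φ).transpose = zeroGram n m (p ^ e) β ζ := by
    ext i j
    rw [Matrix.mul_apply]
    rfl
  have hprod : ((H * hermTranspose (p ^ e) H).submatrix f f).map (algebraMap F K) =
      HK * (HK.map φ).transpose := by
    ext i j
    simp [Matrix.mul_apply, HK, φ, hermTranspose, iterateFrobenius_def]
  rw [← Matrix.rank_submatrix _ f f, ← Matrix.rank_map_ringHom (algebraMap F K), hprod, hA,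
    Matrix.map_mul, Matrix.transpose_mul, ← Matrix.mul_assoc, Matrix.mul_assoc A, hgram,
    Matrix.rank_mul_eq_left_of_isUnit_det _ _ hφdet, Matrix.rank_mul_eq_right_of_isUnit_det _ _ hAdet]

end RootInterval

/-! ### The rank of the Gram matrix through short lattice vectors -/

/-- Such a matrix factors through the index set ι, and it contains c times the identity as a
submatrix. -/
theorem Matrix.rank_of_partial_matching {a b ι K : Type*} [Field K] [Fintype a] [Fintype b]
    [Fintype ι] [DecidableEq ι] (M : Matrix a b K) {f : ι → a} {h : ι → b}
    (hf : f.Injective) (hh : h.Injective) {c : K} (hc : c ≠ 0)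
    (hM : ∀ i, M (f i) (h i) = c) (hM0 : ∀ x y, M x y ≠ 0 → ∃ i, x = f i ∧ y = h i) :
    M.rank = Fintype.card ι := by
  classical
  apply le_antisymm
  · have hfac : M = (Matrix.of fun x i => if x = f i then c else 0 : Matrix a ι K) *
        (Matrix.of fun i y => if y = h i then 1 else 0 : Matrix ι b K) := by
      ext x y
      rw [Matrix.mul_apply]
      simp only [Matrix.of_apply, mul_ite, mul_one, mul_zero]
      by_cases hxy : M x y = 0
      · rw [hxy, Finset.sum_eq_zero]
        intro i _
        split_ifs with h1 h2
        · rw [h1, h2, hM] at hxy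
          exact hxy
        · rfl
        · rfl
      · obtain ⟨i, rfl, rfl⟩ := hM0 x y hxy
        rw [Finset.sum_eq_single i]
        · simp [hM]
        · intro j _ hj
          rw [if_neg fun h => hj (hf h).symm, ite_self]
        · simp
    rw [hfac]
    exact (Matrix.rank_mul_le_left _ _).trans (Matrix.rank_le_card_width _)
  · have hsub : M.submatrix f h = Matrix.diagonal fun _ => c := by
      ext i j
      rw [Matrix.submatrix_apply, Matrix.diagonal_apply]
      split_ifs with hij
      · rw [hij, hM]
      · by_contra hne
        obtain ⟨k, h1, h2⟩ := hM0 _ _ hne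
        exact hij ((hf h1).trans (hh h2).symm)
    have h1 := M.rank_submatrix_le f h
    rw [hsub, Matrix.rank_diagonal] at h1
    simpa [hc] using h1

/-- The short vectors of the lattice `y ≡ q x` modulo `n`. -/
theorem lattice_short_vector {t x y : ℤ} (ht : 0 ≤ t) (hx : |x| ≤ 5 * t + 3)
    (hy : |y| ≤ 5 * t + 3) (h : 10 * t ^ 2 + 14 * t + 5 ∣ y - (10 * t + 7) * x) :
    ∃ a b : ℤ, |a| ≤ 1 ∧ |b| ≤ 1 ∧ x = a * (t + 1) - b * (3 * t + 2) ∧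
      y = a * (3 * t + 2) + b * (t + 1) := by
  obtain ⟨z, hz⟩ := h
  have hn : 0 < 10 * t ^ 2 + 14 * t + 5 := by positivity
  -- The right side is at most (4t+3)(5t+3) = 20t²+27t+9 in absolute value, just below twice n =
  -- 10t²+14t+5.
  have hbound : ∀ c u v : ℤ, |u| ≤ 5 * t + 3 → |v| ≤ 5 * t + 3 →
      (10 * t ^ 2 + 14 * t + 5) * c = (t + 1) * u + (3 * t + 2) * v → |c| ≤ 1 := by
    intro c u v hu hv hc
    rw [abs_le] at hu hv ⊢
    constructor
    · by_contra! hlt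
      have : c ≤ -2 := by omega
      nlinarith [mul_le_mul_of_nonneg_left this hn.le,
        mul_le_mul_of_nonneg_left hu.1 (by omega : 0 ≤ t + 1),
        mul_le_mul_of_nonneg_left hv.1 (by omega : 0 ≤ 3 * t + 2)]
    · by_contra! hlt
      have : 2 ≤ c := by omega
      nlinarith [mul_le_mul_of_nonneg_left this hn.le,
        mul_le_mul_of_nonneg_left hu.2 (by omega : 0 ≤ t + 1),
        mul_le_mul_of_nonneg_left hv.2 (by omega : 0 ≤ 3 * t + 2)]
  -- The coefficients are the projections of (x, y) to the basis (t+1, 3t+2), (-(3t+2), t+1),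
  -- divided by n, with y = (10t+7)x + nz substituted.
  refine ⟨3 * x + (3 * t + 2) * z, x + (t + 1) * z, ?_, ?_, by ring, by linear_combination hz⟩
  · exact hbound _ x y hx hy (by linear_combination (-(3 * t + 2)) * hz)
  · exact hbound _ y (-x) hy (by rwa [abs_neg]) (by linear_combination (-(t + 1)) * hz)

section Gram

variable {K : Type*} [Field K] {n m q : ℕ} {β ζ : K}

/-- The factor β cancels because β^(q+1) = 1, leaving a full geometric sum of an n-th root of unity.
-/
theorem zeroGram_apply (hζ : IsPrimitiveRoot ζ n) (hn : n ≠ 0) (hβ : β ^ (q + 1) = 1)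
    (i j : Finset.Icc (-(m : ℤ)) m) :
    zeroGram n m q β ζ i j = if (n : ℤ) ∣ i.val + q * j.val then (n : K) else 0 := by
  have hζ0 := hζ.ne_zero hn
  have hterm : ∀ l : ℕ, (β * ζ ^ i.val) ^ l * ((β * ζ ^ j.val) ^ l) ^ q =
      (ζ ^ (i.val + q * j.val)) ^ l := by
    intro l
    rw [pow_right_comm, ← mul_pow, mul_pow β, zpow_add₀ hζ0, mul_comm (q : ℤ), zpow_mul,
      zpow_natCast]
    congr 1
    linear_combination (ζ ^ i.val * (ζ ^ j.val) ^ q) * hβ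
  have hsum : zeroGram n m q β ζ i j = ∑ l ∈ Finset.range n, (ζ ^ (i.val + q * j.val)) ^ l := by
    rw [← Fin.sum_univ_eq_sum_range (fun l => (ζ ^ (i.val + q * j.val)) ^ l) n]
    exact Finset.sum_congr rfl fun l _ => hterm l
  rw [hsum]
  split_ifs with h
  · rw [(hζ.zpow_eq_one_iff_dvd _).2 h]
    simp
  · have h1 : ζ ^ (i.val + q * j.val) ≠ 1 := fun h1 => h ((hζ.zpow_eq_one_iff_dvd _).1 h1)
    have h2 := mul_geom_sum (ζ ^ (i.val + q * j.val)) n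
    rw [← zpow_natCast, ← zpow_mul, mul_comm _ (n : ℤ), zpow_mul, zpow_natCast, hζ.pow_eq_one,
      one_zpow, sub_self] at h2
    exact (mul_eq_zero.1 h2).resolve_left (sub_ne_zero.2 h1)

theorem rank_zeroGram {t : ℕ} (ht : 1 ≤ t) (hq : q = 10 * t + 7)
    (hn : n = 10 * t ^ 2 + 14 * t + 5) (hm1 : 4 * t + 3 ≤ m) (hm2 : m ≤ 5 * t + 3)
    (hζ : IsPrimitiveRoot ζ n) (hnK : (n : K) ≠ 0) (hβ : β ^ (q + 1) = 1) :
    (zeroGram n m q β ζ).rank = 9 := by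
  have hn0 : n ≠ 0 := by rintro rfl; simp at hnK
  let A : Fin 3 × Fin 3 → ℤ := fun i => (i.1.val : ℤ) - 1
  let B : Fin 3 × Fin 3 → ℤ := fun i => (i.2.val : ℤ) - 1
  have hA : ∀ i, A i = -1 ∨ A i = 0 ∨ A i = 1 := fun i => by
    have := i.1.isLt
    simp only [A]
    omega
  have hB : ∀ i, B i = -1 ∨ B i = 0 ∨ B i = 1 := fun i => by
    have := i.2.isLt
    simp only [B]
    omega
  have hAB : ∀ i j, A i = A j → B i = B j → i = j := by
    intro i j h1 h2
    simp only [A, B] at h1 h2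
    ext <;> omega
  -- The nine lattice points, with (X, -Y) = A(t+1, 3t+2) + B(-(3t+2), t+1). Coordinates reach (t+1)
  -- + (3t+2) = 4t+3, hence the lower bound on m.
  let X : Fin 3 × Fin 3 → ℤ := fun i => A i * (t + 1) - B i * (3 * t + 2)
  let Y : Fin 3 × Fin 3 → ℤ := fun i => -(A i * (3 * t + 2) + B i * (t + 1))
  have hX : ∀ i, X i ∈ Finset.Icc (-(m : ℤ)) m := by
    intro i
    rw [Finset.mem_Icc]
    simp only [X]
    rcases hA i with h1 | h1 | h1 <;> rcases hB i with h2 | h2 | h2 <;> rw [h1, h2] <;> omega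
  have hY : ∀ i, Y i ∈ Finset.Icc (-(m : ℤ)) m := by
    intro i
    rw [Finset.mem_Icc]
    simp only [Y]
    rcases hA i with h1 | h1 | h1 <;> rcases hB i with h2 | h2 | h2 <;> rw [h1, h2] <;> omega
  -- If b ≠ 0, then |b|(3t+2) exceeds 2(t+1) ≥ |a|(t+1); this uses t ≥ 1.
  have hsmall : ∀ a b : ℤ, -2 ≤ a → a ≤ 2 → -2 ≤ b → b ≤ 2 →
      a * (t + 1) = b * (3 * t + 2) → a = 0 ∧ b = 0 := by
    intro a b h1 h2 h3 h4 h
    interval_cases b <;> interval_cases a <;> omega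
  have hXinj : Function.Injective X := by
    intro i j hij
    simp only [X] at hij
    have hAi := hA i
    have hAj := hA j
    have hBi := hB i
    have hBj := hB j
    obtain ⟨h1, h2⟩ := hsmall (A i - A j) (B i - B j) (by omega) (by omega) (by omega) (by omega)
      (by linear_combination hij)
    exact hAB i j (by omega) (by omega)
  have hYinj : Function.Injective Y := by
    intro i j hij
    simp only [Y] at hij
    have hAi := hA i
    have hAj := hA j
    have hBi := hB i
    have hBj := hB j
    obtain ⟨h1, h2⟩ := hsmall (B i - B j) (A j - A i) (by omega) (by omega) (by omega) (by omega)
      (by linear_combination -hij)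
    exact hAB i j (by omega) (by omega)
  have hcard : Fintype.card (Fin 3 × Fin 3) = 9 := by simp
  rw [← hcard]
  refine Matrix.rank_of_partial_matching _ (f := fun i => ⟨Y i, hY i⟩) (h := fun i => ⟨X i, hX i⟩)
    (fun i j hij => hYinj (congrArg Subtype.val hij))
    (fun i j hij => hXinj (congrArg Subtype.val hij)) hnK (fun i => ?_) (fun x y hxy => ?_)
  · rw [zeroGram_apply hζ hn0 hβ, if_pos]
    refine ⟨A i - 3 * B i, ?_⟩
    simp only [X, Y, hn, hq]
    push_cast
    ring
  · rw [zeroGram_apply hζ hn0 hβ, ne_eq, ite_eq_right_iff, Classical.not_imp] at hxy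
    have hx := x.2
    have hy := y.2
    rw [Finset.mem_Icc] at hx hy
    obtain ⟨a, b, ha, hb, h1, h2⟩ := lattice_short_vector (t := t) (x := y) (y := -x)
      (by positivity) (by rw [abs_le]; omega) (by rw [abs_le]; omega) (by
        have h3 := (dvd_neg (α := ℤ)).2 hxy.1
        rw [hn, hq] at h3
        push_cast at h3
        rwa [neg_add'] at h3)
    rw [abs_le] at ha hb
    refine ⟨(⟨(a + 1).toNat, by omega⟩, ⟨(b + 1).toNat, by omega⟩), ?_, ?_⟩
    · apply Subtype.ext
      have e1 : ((a + 1).toNat : ℤ) = a + 1 := Int.toNat_of_nonneg (by omega)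
      have e2 : ((b + 1).toNat : ℤ) = b + 1 := Int.toNat_of_nonneg (by omega)
      simp only [Y, A, B, e1, e2]
      linear_combination -h2
    · apply Subtype.ext
      have e1 : ((a + 1).toNat : ℤ) = a + 1 := Int.toNat_of_nonneg (by omega)
      have e2 : ((b + 1).toNat : ℤ) = b + 1 := Int.toNat_of_nonneg (by omega)
      simp only [X, A, B, e1, e2]
      linear_combination h1

end Gram

/-! ### The Hermitian dual -/

section HermitianDual

variable {F : Type*} [Field F] {n k : ℕ} {C : Submodule F (Fin n → F)}

/-- The matrix of the quotient map by C, in a basis of the quotient; surjectivity makes its rows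
independent. -/
theorem exists_isParityCheck (C : Submodule F (Fin n → F)) :
    ∃ (k : ℕ) (H : Matrix (Fin k) (Fin n) F), IsParityCheck C H := by
  let f : (Fin n → F) →ₗ[F] (Fin (Module.finrank F ((Fin n → F) ⧸ C)) → F) :=
    (Module.finBasis F ((Fin n → F) ⧸ C)).equivFun.toLinearMap.comp C.mkQ
  have hf : Function.Surjective f :=
    (Module.finBasis F ((Fin n → F) ⧸ C)).equivFun.surjective.comp C.mkQ_surjective
  have hmul : ∀ x, (LinearMap.toMatrix' f).mulVec x = f x := fun x => by
    rw [← Matrix.toLin'_apply, Matrix.toLin'_toMatrix']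
  refine ⟨_, LinearMap.toMatrix' f, ?_, fun x => ?_⟩
  · rw [← Matrix.vecMul_injective_iff]
    intro u v huv
    refine dotProduct_eq _ _ fun y => ?_
    obtain ⟨x, rfl⟩ := hf y
    rw [← hmul, Matrix.dotProduct_mulVec, Matrix.dotProduct_mulVec]
    exact congrArg (fun w => w ⬝ᵥ x) huv
  · rw [hmul]
    simp [f]

variable {p e : ℕ} [Fact p.Prime] [CharP F p] {H : Matrix (Fin k) (Fin n) F}

/-- The space spanned by the conjugates of the rows of `H`. -/
def conjRowSpace (q : ℕ) (H : Matrix (Fin k) (Fin n) F) : Submodule F (Fin n → F) :=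
  LinearMap.range (hermTranspose q H).mulVecLin

theorem sum_hermTranspose_mulVec (y : Fin k → F) (w : Fin n → F) :
    ∑ i, (hermTranspose (p ^ e) H).mulVec y i * w i ^ p ^ e =
      ∑ j, y j * H.mulVec w j ^ p ^ e := by
  simp only [Matrix.mulVec, dotProduct, hermTranspose, sum_pow_char_pow, Finset.sum_mul,
    Finset.mul_sum, mul_pow]
  rw [Finset.sum_comm]
  exact Finset.sum_congr rfl fun j _ => Finset.sum_congr rfl fun i _ => by ring

theorem IsParityCheck.mem_iff_conjRowSpace (hH : IsParityCheck C H) (w : Fin n → F) :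
    w ∈ C ↔ ∀ v ∈ conjRowSpace (p ^ e) H, ∑ i, v i * w i ^ p ^ e = 0 := by
  rw [hH.2]
  constructor
  · rintro hw _ ⟨y, rfl⟩
    have hpos : p ^ e ≠ 0 := pow_ne_zero _ (Fact.out (p := p.Prime)).ne_zero
    rw [Matrix.mulVecLin_apply, sum_hermTranspose_mulVec, hw]
    simp [zero_pow hpos]
  · intro h
    funext j
    have := h _ ⟨Pi.single j 1, rfl⟩
    rw [Matrix.mulVecLin_apply, sum_hermTranspose_mulVec, Finset.sum_eq_single j] at this
    · rw [Pi.single_eq_same, one_mul] at this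
      exact pow_eq_zero_iff (pow_ne_zero _ (Fact.out (p := p.Prime)).ne_zero) |>.1 this
    · intro i _ hi
      simp [hi]
    · simp

/-- Conjugating the orthogonality relations shows that the conjugate of v vanishes on ker H, so it
is a combination of the rows of H; conjugating back is possible because conjugation is an
involution. -/
theorem IsParityCheck.mem_conjRowSpace_iff [Fintype F] (hF : Fintype.card F = (p ^ e) ^ 2)
    (hH : IsParityCheck C H) (v : Fin n → F) :
    v ∈ conjRowSpace (p ^ e) H ↔ ∀ w ∈ C, ∑ i, v i * w i ^ p ^ e = 0 := by
  have hinv : ∀ x : F, (x ^ p ^ e) ^ p ^ e = x := fun x => by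
    rw [← pow_mul, ← sq, ← hF, FiniteField.pow_card]
  refine ⟨fun hv w hw => (hH.mem_iff_conjRowSpace w).1 hw v hv, fun h => ?_⟩
  obtain ⟨A, hA⟩ := Matrix.exists_eq_mul_of_ker_le (a := Unit) (fun _ i => v i ^ p ^ e) H (by
    intro w hw
    funext i
    have h1 := congrArg (fun x => x ^ p ^ e) (h w ((hH.2 w).2 hw))
    simp only [sum_pow_char_pow, mul_pow, hinv] at h1
    rw [zero_pow (pow_ne_zero _ (Fact.out (p := p.Prime)).ne_zero)] at h1
    exact h1)
  refine ⟨fun j => A () j ^ p ^ e, funext fun i => ?_⟩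
  have h1 := congrArg (fun x => x ^ p ^ e) (congrFun (congrFun hA ()) i)
  simp only [hinv, Matrix.mul_apply, sum_pow_char_pow, mul_pow] at h1
  rw [h1, Matrix.mulVecLin_apply]
  simp only [Matrix.mulVec, dotProduct, hermTranspose]
  exact Finset.sum_congr rfl fun j _ => mul_comm _ _

theorem IsParityCheck.finrank_conjRowSpace [Fintype F] (hF : Fintype.card F = (p ^ e) ^ 2)
    (hH : IsParityCheck C H) : Module.finrank F (conjRowSpace (p ^ e) H) = k := by
  have hinv : ∀ x : F, (x ^ p ^ e) ^ p ^ e = x := fun x => by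
    rw [← pow_mul, ← sq, ← hF, FiniteField.pow_card]
  have hpos : p ^ e ≠ 0 := pow_ne_zero _ (Fact.out (p := p.Prime)).ne_zero
  have hinj : Function.Injective (hermTranspose (p ^ e) H).mulVecLin := by
    rw [← LinearMap.ker_eq_bot, LinearMap.ker_eq_bot']
    intro y hy
    have hli := Matrix.vecMul_injective_iff.2 hH.1
    have h0 : (fun j => y j ^ p ^ e) = 0 := by
      refine hli (funext fun i => ?_)
      have h1 := congrArg (fun x => x ^ p ^ e) (congrFun hy i)
      simp only [Matrix.mulVecLin_apply, Matrix.mulVec, dotProduct, hermTranspose,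
        sum_pow_char_pow, mul_pow, hinv, Pi.zero_apply, zero_pow hpos] at h1
      simp only [Pi.zero_apply, Matrix.vecMul, dotProduct, zero_mul,
        Finset.sum_const_zero]
      rw [← h1]
      exact Finset.sum_congr rfl fun j _ => mul_comm _ _
    funext j
    exact (pow_eq_zero_iff hpos).1 (congrFun h0 j)
  rw [conjRowSpace, LinearMap.finrank_range_of_inj hinj, Module.finrank_fin_fun]

/-- Rank-nullity for H restricted to the conjugate row space: the kernel is the intersection with C,
and the image is the column space of HH*. -/
theorem IsParityCheck.finrank_conjRowSpace_eq_add (q : ℕ) (hH : IsParityCheck C H) :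
    Module.finrank F (conjRowSpace q H) =
      Module.finrank F (C ⊓ conjRowSpace q H : Submodule F (Fin n → F)) +
        (H * hermTranspose q H).rank := by
  set D := conjRowSpace q H with hD
  have h1 := (H.mulVecLin.domRestrict D).finrank_range_add_finrank_ker
  have hker : LinearMap.ker (H.mulVecLin.domRestrict D) = C.comap D.subtype := by
    ext x
    rw [LinearMap.mem_ker, Submodule.mem_comap, hH.2]
    rfl
  have hrange : LinearMap.range (H.mulVecLin.domRestrict D) =
      LinearMap.range (H * hermTranspose q H).mulVecLin := by
    rw [LinearMap.range_domRestrict, hD, conjRowSpace, ← LinearMap.range_comp,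
      Matrix.mulVecLin_mul]
  rw [hker, hrange, ← Submodule.finrank_map_subtype_eq, Submodule.map_comap_subtype, inf_comm] at h1
  rw [Matrix.rank, ← h1, add_comm]

end HermitianDual

/-! ### The zeros of the code -/

theorem IsPrimitiveRoot.pow_val_intCast {K : Type*} [Field K] {δ : K} {N : ℕ}
    (hδ : IsPrimitiveRoot δ N) (hN : N ≠ 0) (a : ℤ) : δ ^ (a : ZMod N).val = δ ^ a := by
  have : NeZero N := ⟨hN⟩
  have hδ0 := hδ.ne_zero hN
  rw [← zpow_natCast, ZMod.val_intCast]
  conv_rhs => rw [← Int.emod_add_mul_ediv a N]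
  rw [zpow_add₀ hδ0, zpow_mul, zpow_natCast δ N, hδ.pow_eq_one, one_zpow, mul_one]

theorem mul_natCast_mod (r n j : ℕ) :
    (r : ZMod (r * n)) * ((j % n : ℕ) : ZMod (r * n)) = r * j := by
  have h : ((r * n : ℕ) : ZMod (r * n)) = 0 := ZMod.natCast_self _
  conv_rhs => rw [← Nat.mod_add_div j n]
  push_cast at h ⊢
  linear_combination (-((j / n : ℕ) : ZMod (r * n))) * h

/-- The members of the coset of `s - r j` are `s - r j` and `s + r j`. -/
theorem mul_pow_two_mul_cases {R : Type*} [CommRing R] {s r q : R} (hs : s * q ^ 2 = s)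
    (hr : r * q ^ 2 = -r) (j : R) (e : ℕ) :
    (s - r * j) * q ^ (2 * e) = s - r * j ∨ (s - r * j) * q ^ (2 * e) = s + r * j := by
  induction e with
  | zero => simp
  | succ e ih =>
    rw [mul_add_one, pow_add, ← mul_assoc]
    rcases ih with h | h <;> rw [h]
    · right; linear_combination hs - j * hr
    · left; linear_combination hs + j * hr

theorem isRootInterval_of_definingSet {F K : Type*} [Field F] [Field K] [Algebra F K]
    {q n r s m t : ℕ} (hq : q = 10 * t + 7) (hn : n = 10 * t ^ 2 + 14 * t + 5)
    (hr : r = 10 * t + 8) (hs : s = 5 * n) (hm : 2 * m + 1 ≤ n)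
    {α : F} (hα : α ^ r = 1) {δ : K} (hδ : IsPrimitiveRoot δ (r * n))
    (hδα : δ ^ n = algebraMap F K α) {g : Polynomial F}
    (hg : g ∣ Polynomial.X ^ n - Polynomial.C α)
    (hT : definingSet r n δ g = ⋃ j ∈ Finset.range (m + 1),
      cyclotomicCoset q (r * n) ((s : ZMod (r * n)) - (r : ZMod (r * n)) * (j : ZMod (r * n)))) :
    IsRootInterval n m α g (δ ^ s) (δ ^ r) := by
  have hn0 : n ≠ 0 := by omega
  have hN : r * n ≠ 0 := Nat.mul_ne_zero (by omega) hn0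
  have hδ0 : δ ≠ 0 := hδ.ne_zero hN
  -- So s itself is an admissible exponent 1 + rj, the centre of the interval of zeros.
  have hs1 : s = 1 + r * (5 * t + 3) := by rw [hs, hn, hr]; ring
  have hζ : IsPrimitiveRoot (δ ^ r) n := hδ.pow (Nat.pos_of_ne_zero hN) rfl
  have hpow : (δ ^ s) ^ n = algebraMap F K α := by
    rw [pow_right_comm, hδα, ← map_pow, hs1, pow_add, pow_mul, hα]
    simp
  have hzs : ((r * n : ℕ) : ZMod (r * n)) = 0 := ZMod.natCast_self _
  have hS : (s : ZMod (r * n)) * (q : ZMod (r * n)) ^ 2 = s := by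
    have h : s * q ^ 2 = s + (r * n) * (5 * (10 * t + 6)) := by rw [hs, hq, hr]; ring
    have h' := congrArg (Nat.cast (R := ZMod (r * n))) h
    push_cast at h' hzs
    rw [h', hzs]
    ring
  have hR : (r : ZMod (r * n)) * (q : ZMod (r * n)) ^ 2 = -r := by
    have h : r * q ^ 2 + r = (r * n) * 10 := by rw [hn, hq]; ring
    have h' := congrArg (Nat.cast (R := ZMod (r * n))) h
    push_cast at h' hzs
    rw [hzs] at h'
    linear_combination h'
  have hexp : ∀ j : ℤ, δ ^ s * (δ ^ r) ^ j = δ ^ ((s : ℤ) + r * j) := fun j => by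
    rw [zpow_add₀ hδ0, zpow_mul, zpow_natCast, zpow_natCast]
  refine ⟨hζ, hpow, pow_ne_zero _ hδ0, hm, fun x => ⟨fun hx => ?_, ?_⟩⟩
  · have hxn : x ^ n = algebraMap F K α := by
      obtain ⟨f, hf⟩ := hg
      have h1 := congrArg (Polynomial.aeval x) hf
      rw [map_mul, hx, zero_mul] at h1
      simpa [sub_eq_zero] using h1
    have : NeZero n := ⟨hn0⟩
    obtain ⟨i, hi, hix⟩ := hζ.eq_pow_of_pow_eq_one (ξ := x / δ ^ s) (by
      rw [div_pow, hxn, hpow, div_self]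
      rw [← hpow]
      exact pow_ne_zero _ (pow_ne_zero _ hδ0))
    have hxi : x = δ ^ ((s : ℤ) + r * i) := by
      rw [← hexp, zpow_natCast, hix, mul_div_cancel₀]
      exact pow_ne_zero _ hδ0
    have hmem : (((s : ℤ) + r * i : ℤ) : ZMod (r * n)) ∈ definingSet r n δ g := by
      refine ⟨⟨(5 * t + 3 + i) % n, Nat.mod_lt _ (Nat.pos_of_ne_zero hn0), ?_⟩, ?_⟩
      · rw [mul_natCast_mod, hs1]
        push_cast
        ring
      · rw [hδ.pow_val_intCast hN, ← hxi, hx]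
    rw [hT] at hmem
    simp only [Set.mem_iUnion, Finset.mem_range] at hmem
    obtain ⟨j, hj, e, he⟩ := hmem
    have hval : ∀ k : ℤ, (((s : ℤ) + r * i : ℤ) : ZMod (r * n)) = (((s : ℤ) + r * k : ℤ)) →
        x = δ ^ s * (δ ^ r) ^ k := by
      intro k hk
      rw [hexp, hxi, ← hδ.pow_val_intCast hN, hk, hδ.pow_val_intCast hN]
    rcases mul_pow_two_mul_cases hS hR (j : ZMod (r * n)) e with h | h
    · refine ⟨-j, by rw [Finset.mem_Icc]; omega, hval _ ?_⟩
      rw [he, h]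
      push_cast
      ring
    · refine ⟨j, by rw [Finset.mem_Icc]; omega, hval _ ?_⟩
      rw [he, h]
      push_cast
      ring
  · rintro ⟨j, hj, rfl⟩
    rw [Finset.mem_Icc] at hj
    have hmem : (((s : ℤ) + r * j : ℤ) : ZMod (r * n)) ∈ definingSet r n δ g := by
      rw [hT]
      simp only [Set.mem_iUnion, Finset.mem_range]
      rcases le_total j 0 with h | h
      · refine ⟨j.natAbs, by omega, 0, ?_⟩
        obtain ⟨i, hi⟩ : ∃ i : ℕ, j = -i := ⟨j.natAbs, by omega⟩
        subst hi
        simp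
        ring
      -- For j ≥ 0, s + rj = (s - rj)q² is the second member of the coset, whence the exponent 1;
      -- for j ≤ 0 the representative itself is used.
      · refine ⟨j.natAbs, by omega, 1, ?_⟩
        obtain ⟨i, rfl⟩ := Int.eq_ofNat_of_zero_le h
        simp only [Int.natAbs_natCast, mul_one]
        push_cast
        linear_combination -hS + (i : ZMod (r * n)) * hR
    have h1 := hmem.2
    rwa [hδ.pow_val_intCast hN, ← hexp] at h1


/-! ### The parameters and the resulting code -/

theorem mainTheorem2 (q n r s l : ℕ) (hq : IsPrimePow q) (hq7 : q % 10 = 7)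
    (hn : n = (q ^ 2 + 1) / 10) (hr : r = q + 1) (hs : s = (q ^ 2 + 1) / 2)
    (hl1 : 1 ≤ l) (hl2 : (l : ℚ) ≤ ((q : ℚ) - 7) / 10)
    {F : Type*} [Field F] [Fintype F] [DecidableEq F] (hF : Fintype.card F = q ^ 2)
    {K : Type*} [Field K] [Algebra F K]
    (α : F) (hα : IsPrimitiveRoot α r)
    (δ : K) (hδ : IsPrimitiveRoot δ (r * n)) (hδα : δ ^ n = algebraMap F K α)
    (C : Submodule F (Fin n → F)) (hC : IsConstacyclic α C)
    (g : Polynomial F) (hg : IsGeneratorPoly α C g)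
    (hT : definingSet r n δ g =
      ⋃ j ∈ Finset.range ((2 * q + 1) / 5 + l + 1),
        cyclotomicCoset q (r * n) ((s : ZMod (r * n)) - (r : ZMod (r * n)) * (j : ZMod (r * n)))) :
    ∃ k d : ℕ,
      (k : ℚ) = n - 4 / 5 * (2 * q + 1) - 4 * l + 7 ∧
      (d : ℚ) = 2 / 5 * (2 * q + 1) + 2 * l + 2 ∧
      HasMinWeight C d ∧
      (k : ℤ) = 2 * Module.finrank F C - n + 9 ∧
      (∀ (m : ℕ) (H : Matrix (Fin m) (Fin n) F), IsParityCheck C H →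
        (H * hermTranspose q H).rank = 9) ∧
      ∃ Q : EACode q n k 9, Q.HasMinDist d ∧ MeetsEASingleton n k d 9 ∧
        (q ≠ 17 → Q.IsEAQMDS d) := by
  obtain ⟨t, hqt⟩ : ∃ t, q = 10 * t + 7 := ⟨q / 10, by omega⟩
  have hnt : n = 10 * t ^ 2 + 14 * t + 5 := by
    rw [hn, hqt, show (10 * t + 7) ^ 2 + 1 = 10 * (10 * t ^ 2 + 14 * t + 5) by ring]
    omega
  have hsn : s = 5 * n := by
    rw [hs, hnt, hqt, show (10 * t + 7) ^ 2 + 1 = 2 * (5 * (10 * t ^ 2 + 14 * t + 5)) by ring]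
    omega
  have hrt : r = 10 * t + 8 := by omega
  have hlt : l ≤ t := by
    have h1 : (l : ℚ) ≤ t := by
      rw [hqt] at hl2
      push_cast at hl2
      linarith
    exact_mod_cast h1
  obtain ⟨m, hm⟩ : ∃ m, m = 4 * t + 3 + l := ⟨_, rfl⟩
  have hmT : (2 * q + 1) / 5 + l = m := by omega
  rw [hmT] at hT
  have ht1 : 1 ≤ t := hl1.trans hlt
  have ht2 : t ≤ t ^ 2 := Nat.le_self_pow two_ne_zero t
  -- This is k > 0; it makes the truncated subtraction n + 7 - 4m exact and later excludes C ≤ D.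
  have hkpos : 4 * m < n + 7 := by omega
  have hmn : 2 * m + 1 < n := by omega
  obtain ⟨p, e, hp, -, hpe⟩ := hq
  have hp' : p.Prime := hp.nat_prime
  have : Fact p.Prime := ⟨hp'⟩
  have hp2 : p ≠ 2 := by
    rintro rfl
    have he : e ≠ 0 := by
      rintro rfl
      omega
    have : 2 ∣ q := hpe ▸ dvd_pow_self 2 he
    omega
  have hchF : CharP F p := by
    rw [← hpe, ← pow_mul] at hF
    exact charP_of_card_eq_prime_pow hF
  have hchK : CharP K p := charP_of_injective_algebraMap (algebraMap F K).injective p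
  have hF' : Fintype.card F = (p ^ e) ^ 2 := by rw [hF, hpe]
  have hroot : IsRootInterval n m α g (δ ^ s) (δ ^ r) :=
    isRootInterval_of_definingSet hqt hnt hrt hsn hmn.le hα.pow_eq_one hδ hδα hg.dvd hT
  have hnK : (n : K) ≠ 0 := by
    have hq0 : (q : K) = 0 := by
      rw [← hpe, Nat.cast_pow, CharP.cast_eq_zero, zero_pow]
      rintro rfl
      rw [pow_zero] at hpe
      omega
    intro h0
    -- In K this reads 1 = 10n, since q vanishes there.
    have h1 : q ^ 2 + 1 = 10 * n := by rw [hqt, hnt]; ring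
    have h2 := congrArg (Nat.cast (R := K)) h1
    push_cast at h2
    rw [hq0, h0] at h2
    norm_num at h2
  have hβ : (δ ^ s) ^ (q + 1) = 1 := by
    rw [← pow_mul, hsn, ← hr, show 5 * n * r = r * n * 5 by ring, pow_mul, hδ.pow_eq_one, one_pow]
  have hrank : ∀ (k : ℕ) (H : Matrix (Fin k) (Fin n) F), IsParityCheck C H →
      (H * hermTranspose q H).rank = 9 := by
    intro k H hH
    rw [← rank_zeroGram (m := m) ht1 hqt hnt (by omega) (by omega) hroot.primitive hnK hβ, ← hpe]
    exact hroot.rank_hermitian hg hH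
  have hdeg := hroot.natDegree_eq hg
  have hdim : Module.finrank F C = n - (2 * m + 1) := by
    rw [hg.finrank_eq (by omega), hdeg]
  obtain ⟨k₀, H, hH⟩ := exists_isParityCheck C
  have hk₀ := hH.finrank_add
  have hDdim := hH.finrank_conjRowSpace hF'
  have hDadd := hH.finrank_conjRowSpace_eq_add q
  rw [hrank _ H hH] at hDadd
  rw [hpe] at hDdim
  have hCadd : Module.finrank F C = Module.finrank F
      (C ⊓ conjRowSpace q H : Submodule F (Fin n → F)) + (n + 7 - 4 * m) := by omega
  have hγ : ∃ γ : F, γ ≠ 0 ∧ γ ^ q = -γ := by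
    -- Conjugation exchanges α and α^q, which differ because α has order q + 1.
    refine ⟨α - α ^ q, fun h => ?_, ?_⟩
    · have h1 := hα.pow_inj (i := 1) (j := q) (by omega) (by omega)
        (by rw [pow_one]; exact sub_eq_zero.1 h)
      omega
    · rw [← hpe, sub_pow_char_pow, ← pow_mul α, ← sq, ← hF', FiniteField.pow_card, neg_sub]
  obtain ⟨γ, hγ0, hγ⟩ := hγ
  have hex : ∃ w ∈ C, w ∉ conjRowSpace q H ∧ hammingNorm w = 2 * m + 2 := by
    by_contra! hcon
    have hle : C ≤ conjRowSpace q H := by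
      conv_lhs => rw [hg.eq_span (by omega)]
      rw [Submodule.span_le]
      rintro _ ⟨j, rfl⟩
      have hj : j.val + g.natDegree < n := by have := j.isLt; omega
      by_contra hnot
      exact hcon _ (hg.shiftWord_mem hj) hnot (hroot.hammingNorm_shiftWord hg hj)
    rw [inf_eq_left.2 hle] at hCadd
    omega
  obtain ⟨Q, hQ⟩ := exists_eaCode_of_hermitian (k := n + 7 - 4 * m) (c := 9) hp' hp2 hpe.symm hF
    hγ0 hγ C (conjRowSpace q H) (fun w => by rw [← hpe]; exact hH.mem_iff_conjRowSpace w)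
    (fun v => by rw [← hpe]; exact hH.mem_conjRowSpace_iff hF' v) hCadd hDadd
    (fun w hw hw0 => hroot.le_hammingNorm hg hw hw0) hex
  have hkm : ((n + 7 - 4 * m : ℕ) : ℤ) = n + 7 - 4 * m := by omega
  have hsing : MeetsEASingleton n (n + 7 - 4 * m) (2 * m + 2) 9 := by
    rw [MeetsEASingleton, hkm]
    push_cast
    ring
  refine ⟨n + 7 - 4 * m, 2 * m + 2, ?_, ?_, hroot.hasMinWeight hg hmn, ?_, hrank, Q, hQ, hsing,
    fun hq17 => ⟨hQ, hsing, ?_⟩⟩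
  · have h1 : ((n + 7 - 4 * m : ℕ) : ℚ) = n + 7 - 4 * m := by exact_mod_cast hkm
    rw [h1, hm, hqt]
    push_cast
    ring
  · rw [hm, hqt]
    push_cast
    ring
  · omega
  -- Excluding q = 17 leaves t ≥ 2. For t = 1 one has n = 29 and d = 18 > 31/2.
  · have h0 : 2 * t ≤ t ^ 2 := by
      rw [sq]
      exact Nat.mul_le_mul_right t (by omega)
    have h1 : 2 * (2 * m + 2) ≤ n + 2 := by omega
    have h2 : (2 : ℚ) * ((2 * m + 2 : ℕ) : ℚ) ≤ n + 2 := by exact_mod_cast h1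
    linarith
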